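/- Let $N\ge 0$ and let $\hbar$ be a formal parameter. Write $z=(z^\mu)=(x_1,\dots,x_N,p_1,\dots,p_N)$ for the coordinates on $T^*\mathbb R^N$, $(J^{\mu\nu})=\begin{pmatrix}0&I_N\\-I_N&0\end{pmatrix}$, and call the elements of $C^\infty(T^*\mathbb R^N)[[\hbar]]$ (complex-valued coefficients) *symbols*. **Weyl quantization.** The operator $\widehat A$ with symbol $A$ is given by Weyl's formula $$(\widehat A\varphi)(x)=\int\frac{dy\,dp}{(2\pi\hbar)^N}\,e^{i(x-y)\cdot p/\hbar}A\Big(\frac{x+y}2,p\Big)\varphi(y),$$ understood formally in $\hbar$: it acts on formal oscillatory functions $\varphi(x)=e^{ip_0\cdot x/\hbar}u(x)$, $p_0\in\mathbb R^N$, $u\in C^\infty(\mathbb R^N)[[\hbar]]$, by $$(\widehat A\varphi)(x)=e^{ip_0\cdot x/\hbar}\sum_{k\ge0}\frac{(-i\hbar)^k}{k!}\Big(\sum_{j}\partial_{y_j}\partial_{p_j}\Big)^k\Big[A\Big(\frac{x+y}2,p\Big)u(y)\Big]_{y=x,\;p=p_0}.$$ **Functions of an operator.** Let $A=\sum_k\hbar^kA_k$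 be a symbol with $A_0$ real-valued. Let $\mathcal A$ be a unital algebra of smooth functions $\mathbb R\to\mathbb R$ which contains $y\mapsto y$ and has the property that, whenever $g$ is smooth, $a\in\mathbb R$ and $(y-a)g(y)\in\mathcal A$, then $g\in\mathcal A$ (for instance all smooth functions, or all real-analytic functions). Let $g\mapsto g(\widehat A)$ be a functional calculus on $\mathcal A$, that is, any unital homomorphism of real algebras from $\mathcal A$ to the $\mathbb C$-linear operators on families $(u_{p_0})_{p_0\in\mathbb R^N}$ of amplitudes $u_{p_0}\in C^\infty(\mathbb R^N)[[\hbar]]$ (the amplitudes of $e^{ip_0\cdot x/\hbar}$) that sends $y\mapsto y$ to $\widehat A$ and all of whose values are operators that have a symbol. For smooth $g$, $g(A)$ denotes the pointwise composition $\sum_{j\ge0}\frac1{j!}g^{(j)}(A_0)(A-A_0)^j$. **Graphs.** A *labeled graph* with $V$ vertices and $E$ edges is a map $\Gamma$ from $\{1,\dots,E\}$ to the two-element subsets of $\{1,\dots,V\}$ ($V,E\ge0$); each edge is oriented from its smaller to its larger end point. It is *reduced* if every vertex lies on an edge. An *unlabeled graph* is an orbit $[\Gamma]$ of the relabeling action of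 $S_V\times S_E$ and is reduced if its members are. $S_\Gamma$ is the order of the stabilizer of $\Gamma$ in $S_V\times S_E$, and $$c_\Gamma=\sum_{\sigma\in S_V}(-1)^{\#\{\text{edges } u\to v \text{ of }\Gamma\;:\;\sigma(u)>\sigma(v)\}} .$$ $\lambda_\Gamma(A)$ is obtained by putting a copy of $A$ at each vertex and, for each edge $e$, a factor $J^{\mu_e\nu_e}$, applying $\partial_{\mu_e}$ to the copy at the tail of $e$ and $\partial_{\nu_e}$ to the copy at its head, multiplying everything, and summing over all indices. **Theorem.** Let $f\in\mathcal A$ and let $B$ be the symbol of $f(\widehat A)$. Then, as formal power series in $\hbar$ (for each $n$ only finitely many terms contribute to the coefficient of $\hbar^n$), $$B=\sum_{\Gamma\text{ reduced labeled graph}}\frac1{E!}\Big(\frac{i\hbar}2\Big)^E\frac{f^{(V)}(A)}{V!}\,\lambda_\Gamma(A)$$ and $$B=\sum_{[\Gamma]\text{ reduced unlabeled graph}}\Big(\frac{i\hbar}2\Big)^E\frac{c_\Gamma}{S_\Gamma}\,\lambda_\Gamma(A)\,\frac{f^{(V)}(A)}{V!},$$ where in the second sum $\Gamma$ is any labeled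 representative of $[\Gamma]$, and the formula holds for every choice of representatives. -/

import Mathlib

open scoped ContDiff

noncomputable section

namespace SymbolCalculus

/-! ### Smooth functions and formal symbols -/

/-- The algebra `C^∞(ℝ^ι)` of smooth complex-valued functions, with pointwise operations. -/
def Smooth (ι : Type) [Fintype ι] : Subalgebra ℂ ((ι → ℝ) → ℂ) where
  carrier := {F | ContDiff ℝ ∞ F}
  mul_mem' {F G} (hF : ContDiff ℝ ∞ F) (hG : ContDiff ℝ ∞ G) := hF.mul hG
  add_mem' {F G} (hF : ContDiff ℝ ∞ F) (hG : ContDiff ℝ ∞ G) := hF.add hG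
  algebraMap_mem' c := (contDiff_const : ContDiff ℝ ∞ fun _ : ι → ℝ => c)

theorem contDiff_coe {ι : Type} [Fintype ι] (F : Smooth ι) : ContDiff ℝ ∞ F.1 := F.2

/-- The partial derivative `∂F/∂w^i` as an operator on smooth functions. -/
def pd {ι : Type} [Fintype ι] [DecidableEq ι] (i : ι) : Smooth ι →ₗ[ℂ] Smooth ι where
  toFun F := ⟨fun w => fderiv ℝ F.1 w (Pi.single i 1),
    ((contDiff_coe F).fderiv_right (m := ∞) (by simp)).clm_apply contDiff_const⟩
  map_add' F G := by
    apply Subtype.ext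
    funext w
    have hF : DifferentiableAt ℝ F.1 w := ((contDiff_coe F).differentiable (by simp)) w
    have hG : DifferentiableAt ℝ G.1 w := ((contDiff_coe G).differentiable (by simp)) w
    change fderiv ℝ (F.1 + G.1) w (Pi.single i 1) = _
    rw [fderiv_add hF hG]
    rfl
  map_smul' c F := by
    apply Subtype.ext
    funext w
    have hF : DifferentiableAt ℝ F.1 w := ((contDiff_coe F).differentiable (by simp)) w
    change fderiv ℝ (c • F.1) w (Pi.single i 1) = _
    rw [fderiv_const_smul hF]
    rfl

/-- Pull-back of smooth functions along a smooth map. -/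
def pullback {ι κ : Type} [Fintype ι] [Fintype κ] (φ : (ι → ℝ) → (κ → ℝ))
    (hφ : ContDiff ℝ ∞ φ) : Smooth κ →ₐ[ℂ] Smooth ι where
  toFun F := ⟨fun w => F.1 (φ w), (contDiff_coe F).comp hφ⟩
  map_one' := rfl
  map_mul' _ _ := rfl
  map_zero' := rfl
  map_add' _ _ := rfl
  commutes' _ := rfl

/-- Indices of the coordinates of `T*ℝ^N`: `Sum.inl j` is `x_j` and `Sum.inr j` is `p_j`. -/
abbrev PhaseIdx (N : ℕ) : Type := Fin N ⊕ Fin N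

/-- Formal symbols, the elements of `C^∞(T*ℝ^N)[[ħ]]`; the power series variable is `ħ`. -/
abbrev Symbol (N : ℕ) : Type := PowerSeries (Smooth (PhaseIdx N))

/-- The partial derivative `∂_μ` of a formal symbol, coefficient by coefficient in `ħ`. -/
def pdSymbol {N : ℕ} (μ : PhaseIdx N) (A : Symbol N) : Symbol N :=
  PowerSeries.mk fun n => pd μ (PowerSeries.coeff n A)

/-! ### Formal Weyl quantization

With `ħ` a formal parameter, operators act on oscillatory functions
`φ(x) = e^{i p₀·x/ħ} u(x)`, where `p₀ ∈ ℝ^N` and `u ∈ C^∞(ℝ^N)[[ħ]]`. The Weyl formula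
`(Â φ)(x) = (2πħ)^{-N} ∫∫ e^{i(x-y)·p/ħ} A((x+y)/2, p) φ(y) dy dp`
then reads, by complete stationary phase expansion at its only critical point `y = x`, `p = p₀`
(and exactly when `A` is polynomial in `p`),
`(Â φ)(x) = e^{i p₀·x/ħ} · exp(-iħ ∑_j ∂_{y_j} ∂_{p_j}) [A((x+y)/2, p) u(y)]` at `y = x`, `p = p₀`.
In particular `x̂_j` is multiplication by `x_j` and `p̂_j` is `-iħ ∂/∂x_j`. -/

/-- Formal oscillatory functions: `u p₀` is the amplitude that multiplies `e^{i p₀·x/ħ}`. -/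
abbrev Wave (N : ℕ) : Type := (Fin N → ℝ) → PowerSeries (Smooth (Fin N))

/-- Indices of the coordinates `(x, y, p)` of `ℝ^N × ℝ^N × ℝ^N`, in this order. -/
abbrev TripleIdx (N : ℕ) : Type := Fin N ⊕ (Fin N ⊕ Fin N)

/-- The map `(x, y, p) ↦ ((x + y) / 2, p)`. -/
def midpointMap (N : ℕ) (w : TripleIdx N → ℝ) : PhaseIdx N → ℝ :=
  Sum.elim (fun j => (w (Sum.inl j) + w (Sum.inr (Sum.inl j))) / 2)
    (fun j => w (Sum.inr (Sum.inr j)))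

/-- The map `(x, y, p) ↦ y`. -/
def middleMap (N : ℕ) (w : TripleIdx N → ℝ) : Fin N → ℝ := fun j => w (Sum.inr (Sum.inl j))

/-- The map `x ↦ (x, x, p₀)`. -/
def diagonalMap {N : ℕ} (p₀ : Fin N → ℝ) (x : Fin N → ℝ) : TripleIdx N → ℝ :=
  Sum.elim x (Sum.elim x p₀)

theorem contDiff_midpointMap (N : ℕ) : ContDiff ℝ ∞ (midpointMap N) := by
  rw [contDiff_pi]
  rintro (j | j) <;> simp only [midpointMap, Sum.elim_inl, Sum.elim_inr] <;> fun_prop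

theorem contDiff_middleMap (N : ℕ) : ContDiff ℝ ∞ (middleMap N) := by
  unfold middleMap
  fun_prop

theorem contDiff_diagonalMap {N : ℕ} (p₀ : Fin N → ℝ) : ContDiff ℝ ∞ (diagonalMap p₀) := by
  rw [contDiff_pi]
  rintro (j | j | j) <;> simp only [diagonalMap, Sum.elim_inl, Sum.elim_inr] <;> fun_prop

/-- The operator `∑_j ∂_{y_j} ∂_{p_j}` on functions of `(x, y, p)`. -/
def crossLaplacian (N : ℕ) : Smooth (TripleIdx N) →ₗ[ℂ] Smooth (TripleIdx N) :=
  ∑ j : Fin N, pd (Sum.inr (Sum.inl j)) ∘ₗ pd (Sum.inr (Sum.inr j))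

/-- The `k`-th term (without `ħ^k`) of the Weyl operator with symbol `a` on `e^{i p₀·x/ħ} v`:
`((-i)^k / k!) (∑_j ∂_{y_j} ∂_{p_j})^k [a((x+y)/2, p) v(y)]` at `y = x`, `p = p₀`. -/
def weylTerm {N : ℕ} (k : ℕ) (a : Smooth (PhaseIdx N)) (p₀ : Fin N → ℝ) (v : Smooth (Fin N)) :
    Smooth (Fin N) :=
  ((-Complex.I) ^ k / (k.factorial : ℂ)) •
    pullback (diagonalMap p₀) (contDiff_diagonalMap p₀)
      ((crossLaplacian N ^ k)
        (pullback (midpointMap N) (contDiff_midpointMap N) a *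
          pullback (middleMap N) (contDiff_middleMap N) v))

/-- Weyl quantization `A ↦ Â` for formal `ħ`: the coefficient of `ħ^n` collects the terms
`ħ^k · ħ^m · ħ^l` with `k + m + l = n`, where `ħ^m` comes from `A` and `ħ^l` from the amplitude. -/
def weylOp {N : ℕ} (A : Symbol N) : Module.End ℂ (Wave N) where
  toFun u := fun p₀ => PowerSeries.mk fun n =>
    ∑ q ∈ Finset.HasAntidiagonal.antidiagonal n, ∑ r ∈ Finset.HasAntidiagonal.antidiagonal q.2,
      weylTerm q.1 (PowerSeries.coeff r.1 A) p₀ (PowerSeries.coeff r.2 (u p₀))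
  map_add' u v := by
    funext p₀
    ext1 n
    simp [weylTerm, mul_add, Finset.sum_add_distrib]
  map_smul' c u := by
    funext p₀
    ext1 n
    simp [weylTerm, Finset.smul_sum, smul_comm c]

/-! ### Functions of a formal symbol, pointwise -/

/-- The smooth function `z ↦ f(Re a(z))`; it is used for real-valued `a`. -/
def realComp {N : ℕ} (f : ℝ → ℝ) (hf : ContDiff ℝ ∞ f) (a : Smooth (PhaseIdx N)) :
    Smooth (PhaseIdx N) :=
  ⟨fun z => ((f (a.1 z).re : ℝ) : ℂ),
    Complex.ofRealCLM.contDiff.comp (hf.comp (Complex.reCLM.contDiff.comp (contDiff_coe a)))⟩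

/-- The derivatives of a smooth function are smooth. -/
theorem contDiff_iteratedDeriv {f : ℝ → ℝ} (hf : ContDiff ℝ ∞ f) (k : ℕ) :
    ContDiff ℝ ∞ (iteratedDeriv k f) := by
  rw [iteratedDeriv_eq_iterate]
  exact hf.iterate_deriv k

/-- The formal symbol `f(A)` (pointwise, not operator, composition) for `A = A₀ + ħ A₁ + ⋯` with
`A₀` real-valued: `f(A) = ∑_j f^{(j)}(A₀) (A - A₀)^j / j!`, in which only the terms with `j ≤ n`
contribute to `ħ^n`. -/
def compSymbol {N : ℕ} (f : ℝ → ℝ) (hf : ContDiff ℝ ∞ f) (A : Symbol N) : Symbol N :=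
  PowerSeries.mk fun n => ∑ j ∈ Finset.range (n + 1),
    (1 / (j.factorial : ℂ)) •
      (realComp (iteratedDeriv j f) (contDiff_iteratedDeriv hf j) (PowerSeries.coeff 0 A) *
        PowerSeries.coeff n ((A - PowerSeries.C (PowerSeries.coeff 0 A)) ^ j))

/-! ### Graphs -/

/-- A labeled graph with `V` vertices and `E` edges: each edge joins two distinct vertices. -/
def LabeledGraph (V E : ℕ) : Type := Fin E → {t : Finset (Fin V) // t.card = 2}

namespace LabeledGraph

variable {V E : ℕ}

theorem nonempty_edge (Γ : LabeledGraph V E) (e : Fin E) : (Γ e).1.Nonempty := by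
  rw [← Finset.card_pos, (Γ e).2]
  norm_num

/-- Every edge is oriented from its smaller end point, the tail. -/
def tail (Γ : LabeledGraph V E) (e : Fin E) : Fin V := (Γ e).1.min' (Γ.nonempty_edge e)

/-- Every edge is oriented towards its larger end point, the head. -/
def head (Γ : LabeledGraph V E) (e : Fin E) : Fin V := (Γ e).1.max' (Γ.nonempty_edge e)

/-- A labeled graph is reduced if it has no isolated vertex. -/
def Reduced (Γ : LabeledGraph V E) : Prop := ∀ v : Fin V, ∃ e : Fin E, v ∈ (Γ e).1

/-- `S_V × S_E` acts on labeled graphs by relabeling vertices and edges. -/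
instance : MulAction (Equiv.Perm (Fin V) × Equiv.Perm (Fin E)) (LabeledGraph V E) where
  smul g Γ := fun e => ⟨(Γ (g.2⁻¹ e)).1.map g.1.toEmbedding,
    by rw [Finset.card_map]; exact (Γ (g.2⁻¹ e)).2⟩
  one_smul Γ := by
    funext e
    apply Subtype.ext
    change (Γ e).1.map (Equiv.refl _).toEmbedding = _
    simp
  mul_smul g h Γ := by
    funext e
    apply Subtype.ext
    change (Γ ((g.2 * h.2)⁻¹ e)).1.map (g.1 * h.1).toEmbedding
      = ((Γ (h.2⁻¹ (g.2⁻¹ e))).1.map h.1.toEmbedding).map g.1.toEmbedding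
    rw [Finset.map_map, mul_inv_rev]
    rfl

/-- The order of symmetry `S_Γ`. -/
def symm (Γ : LabeledGraph V E) : ℕ :=
  Nat.card (MulAction.stabilizer (Equiv.Perm (Fin V) × Equiv.Perm (Fin E)) Γ)

/-- `c_Γ`: the `V!` renumberings of the vertices, counted with the sign
`(-1)^(number of arrows that they invert)`. -/
def c (Γ : LabeledGraph V E) : ℤ :=
  ∑ σ : Equiv.Perm (Fin V),
    (-1) ^ (Finset.univ.filter fun e : Fin E => σ (Γ.head e) < σ (Γ.tail e)).card

end LabeledGraph

/-- An unlabeled graph with `V` vertices and `E` edges: an orbit of `S_V × S_E`. -/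
abbrev Graph (V E : ℕ) : Type :=
  MulAction.orbitRel.Quotient (Equiv.Perm (Fin V) × Equiv.Perm (Fin E)) (LabeledGraph V E)

/-- The unlabeled graph `[Γ]` of a labeled graph `Γ`. -/
def LabeledGraph.toGraph {V E : ℕ} (Γ : LabeledGraph V E) : Graph V E := Quotient.mk _ Γ

/-- An unlabeled graph is reduced if it is the class of a reduced labeled graph. -/
def Graph.Reduced {V E : ℕ} (q : Graph V E) : Prop :=
  ∃ Γ : LabeledGraph V E, Γ.toGraph = q ∧ Γ.Reduced

/-- The coefficients `J^{μν}` of the Poisson tensor, the block matrix `(0, I; -I, 0)`. -/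
def poissonTensor (N : ℕ) : Matrix (PhaseIdx N) (PhaseIdx N) ℂ := Matrix.fromBlocks 0 1 (-1) 0

/-- The derivative of `C` that stands at the vertex `v` of `Γ` in `λ_Γ`: one factor `∂_{μ e}` for
every edge `e` that starts at `v` and one factor `∂_{ν e}` for every edge `e` that ends at `v`. -/
def vertexDeriv {N V E : ℕ} (Γ : LabeledGraph V E) (μ ν : Fin E → PhaseIdx N) (v : Fin V)
    (C : Symbol N) : Symbol N :=
  (List.finRange E).foldr
    (fun e F => if Γ.tail e = v then pdSymbol (μ e) F
      else if Γ.head e = v then pdSymbol (ν e) F else F) C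

/-- `λ_Γ(C_1, …, C_V)`: the edge `e` stands for `J^{μ_e ν_e}`, its tail is differentiated by
`∂_{μ_e}` and its head by `∂_{ν_e}`; repeated indices are summed over. -/
def graphPoly {N V E : ℕ} (Γ : LabeledGraph V E) (C : Fin V → Symbol N) : Symbol N :=
  ∑ μ : Fin E → PhaseIdx N, ∑ ν : Fin E → PhaseIdx N,
    (∏ e : Fin E, poissonTensor N (μ e) (ν e)) • ∏ v : Fin V, vertexDeriv Γ μ ν v (C v)

/-! ### The formal series over graphs -/

/-- The formal symbol `(iħ/2)^E`. -/
def planckFactor (N E : ℕ) : Symbol N := ((Complex.I / 2) • (PowerSeries.X : Symbol N)) ^ E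

/-- `(1/E!) (iħ/2)^E (f^{(V)}(A)/V!) λ_Γ(A)`. -/
def labeledTerm {N V E : ℕ} (f : ℝ → ℝ) (hf : ContDiff ℝ ∞ f) (A : Symbol N)
    (Γ : LabeledGraph V E) : Symbol N :=
  (1 / (E.factorial : ℂ)) • (planckFactor N E *
    ((1 / (V.factorial : ℂ)) • compSymbol (iteratedDeriv V f) (contDiff_iteratedDeriv hf V) A) *
    graphPoly Γ fun _ => A)

/-- `(iħ/2)^E (c_Γ/S_Γ) λ_Γ(A) (f^{(V)}(A)/V!)`. -/
def unlabeledTerm {N V E : ℕ} (f : ℝ → ℝ) (hf : ContDiff ℝ ∞ f) (A : Symbol N)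
    (Γ : LabeledGraph V E) : Symbol N :=
  ((Γ.c : ℂ) / (Γ.symm : ℂ)) • (planckFactor N E * (graphPoly Γ fun _ => A) *
    ((1 / (V.factorial : ℂ)) • compSymbol (iteratedDeriv V f) (contDiff_iteratedDeriv hf V) A))

/-- `B = ∑_i t_i` as formal power series: in each degree only finitely many terms contribute, and
they add up to the coefficient of `B`. -/
def HasFormalSum {ι R : Type} [CommRing R] (t : ι → PowerSeries R) (B : PowerSeries R) : Prop :=
  ∀ n : ℕ, (Function.support fun i => PowerSeries.coeff n (t i)).Finite ∧
    ∑ᶠ i, PowerSeries.coeff n (t i) = PowerSeries.coeff n B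

/-! ### Algebras of functions -/

/-- `𝒜` consists of smooth functions `ℝ → ℝ`, contains the coordinate function `y ↦ y`, and
contains every smooth quotient of an element of `𝒜` by `y - a`. The algebra of all smooth functions
and the algebra of all real-analytic functions are examples. -/
structure IsFunctionAlgebra (𝒜 : Subalgebra ℝ (ℝ → ℝ)) : Prop where
  smooth : ∀ g ∈ 𝒜, ContDiff ℝ ∞ g
  id_mem : (fun y : ℝ => y) ∈ 𝒜
  div_mem : ∀ (a : ℝ) (g : ℝ → ℝ), ContDiff ℝ ∞ g → (fun y => (y - a) * g y) ∈ 𝒜 → g ∈ 𝒜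

end SymbolCalculus

end

noncomputable section

namespace SymbolCalculus

open PowerSeries (mapAlgHom)

/-! ### Differential operators with constant coefficients -/

section Operators

variable {ι κ : Type} [Fintype ι] [DecidableEq ι] [Fintype κ] [DecidableEq κ]

/-! On plane waves Weyl operators act through exponentials of constant-coefficient operators. The
product `Â_1 ⋯ Â_V`, applied to `e^{i p₀·x/ħ}`, has amplitude `exp(-iħ Q)[F_1(z_1) ⋯ F_V(z_V)]` at
`z_v = (x, p₀)`, where `Q` is the operator of `wavePoly` (`weylProd_one`). A quadratic identity
(`aeval_leftPoly_add_edgePoly`) rewrites this as `exp(-(iħ/2) ∑ ∂_x ∂_p)` of the Moyal product `F_1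
⋆ ⋯ ⋆ F_V`. That exponential is invertible, so the action on plane waves determines a symbol
(`HasSymbol.unique`), and the symbol of a product can be read off. The `E`-th power of the Moyal
exponent is a sum over labeled graphs with `E` edges (`edgePoly_pow`).

Now fix a point `z`, let `a = A(z)` as a series in `ħ`, and let `a₀` be its real leading term.
Expand `f` at `a₀` inside `𝒜` up to a remainder `g·(y - a₀)^n`, and apply the functional calculus.
Since `Â - a₀` is the operator of `A - a` plus the central constant `a - a₀`, its powers expand
binomially. In the `V`-fold star power of `A - a`, evaluated at `z`, an isolated vertex contributes
the factor `0`, while at a vertex on an edge the constant `a` is differentiated away: exactly the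
reduced graphs of `A` survive. Their coefficients resum to `f^{(V)}(A)(z)/V!`. In the remainder, `E`
edges touch at most `2E` vertices and each untouched copy of `A - a₀` is divisible by `ħ` at `z`;
hence `n = 2m + 1` removes it at order `ħ^m` (`coeff_evalSymbol_star_eq_zero`).

For unlabeled graphs, antisymmetry of `J` makes a relabeling change `λ_Γ` only by a sign. Summing
over `S_V × S_E` in two ways gives the factor `c_Γ/S_Γ` (`LabeledGraph.sum_orbit_graphPoly`). -/

omit [DecidableEq ι] in
theorem differentiable_coe (F : Smooth ι) : Differentiable ℝ F.1 :=
  (contDiff_coe F).differentiable (by simp)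

theorem pd_comm (i j : ι) (F : Smooth ι) : pd i (pd j F) = pd j (pd i F) := by
  apply Subtype.ext
  funext w
  have hd : DifferentiableAt ℝ (fderiv ℝ F.1) w :=
    (((contDiff_coe F).fderiv_right (m := ∞) (by simp)).differentiable (by simp)) w
  have key : ∀ i j : ι, (pd i (pd j F)).1 w
      = fderiv ℝ (fderiv ℝ F.1) w (Pi.single i 1) (Pi.single j 1) := by
    intro i j
    change fderiv ℝ (fun w => fderiv ℝ F.1 w (Pi.single j 1)) w (Pi.single i 1) = _
    rw [fderiv_clm_apply hd (differentiableAt_const _)]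
    simp
  rw [key, key]
  exact ((contDiff_coe F).contDiffAt.isSymmSndFDerivAt (by
    rw [minSmoothness_of_isRCLikeNormedField]
    exact (WithTop.coe_le_coe.2 le_top : ((2 : ℕ∞) : WithTop ℕ∞) ≤ ((⊤ : ℕ∞) : WithTop ℕ∞)))).eq _ _

theorem pd_mul (i : ι) (F G : Smooth ι) : pd i (F * G) = pd i F * G + F * pd i G := by
  apply Subtype.ext
  funext w
  change fderiv ℝ (F.1 * G.1) w (Pi.single i 1) = _
  rw [fderiv_mul (differentiable_coe F w) (differentiable_coe G w)]
  change F.1 w * fderiv ℝ G.1 w (Pi.single i 1) + G.1 w * fderiv ℝ F.1 w (Pi.single i 1)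
    = fderiv ℝ F.1 w (Pi.single i 1) * G.1 w + F.1 w * fderiv ℝ G.1 w (Pi.single i 1)
  ring

theorem pd_one (i : ι) : pd i (1 : Smooth ι) = 0 := by
  have h := pd_mul i (1 : Smooth ι) 1
  simpa using h

/-- The commutative algebra of differential operators with constant coefficients. -/
abbrev diffAlg (ι : Type) [Fintype ι] [DecidableEq ι] :
    Subalgebra ℂ (Module.End ℂ (Smooth ι)) :=
  Algebra.adjoin ℂ (Set.range (pd (ι := ι)))

theorem pd_mem_diffAlg (i : ι) : pd i ∈ diffAlg ι := Algebra.subset_adjoin ⟨i, rfl⟩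

/-- Symmetry of second derivatives. Commutativity is what allows partial derivatives to be
substituted for polynomial variables, so that computations with exponentials of operators become
polynomial identities. -/
instance : IsMulCommutative (diffAlg ι) := by
  apply Algebra.isMulCommutative_adjoin
  rintro _ ⟨i, rfl⟩ _ ⟨j, rfl⟩
  ext1 F
  exact pd_comm i j F

open scoped IsMulCommutative in
/-- The differential operator `P(∂)`. -/
def opOf : MvPolynomial ι ℂ →ₐ[ℂ] Module.End ℂ (Smooth ι) :=
  (diffAlg ι).val.comp
    (MvPolynomial.aeval fun i => (⟨pd i, pd_mem_diffAlg i⟩ : diffAlg ι))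

open scoped IsMulCommutative in
@[simp]
theorem opOf_X (i : ι) : opOf (MvPolynomial.X i) = pd i := by
  simp [opOf]

theorem opOf_C (c : ℂ) (F : Smooth ι) : opOf (MvPolynomial.C c) F = c • F := by
  have : opOf (MvPolynomial.C c : MvPolynomial ι ℂ) = algebraMap ℂ _ c :=
    opOf.commutes c
  rw [this]
  rfl

theorem opOf_mul_apply (P Q : MvPolynomial ι ℂ) (F : Smooth ι) :
    opOf (P * Q) F = opOf P (opOf Q F) := by
  rw [map_mul]
  rfl

/-- Both sides are multiplicative in `P`, so checking the variables is enough. For `φ` a pull-back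
along an affine map, this moves differential operators through the pull-back. -/
theorem opOf_intertwine (φ : Smooth κ →ₗ[ℂ] Smooth ι)
    (h : MvPolynomial ι ℂ →ₐ[ℂ] MvPolynomial κ ℂ)
    (hX : ∀ i F, pd i (φ F) = φ (opOf (h (MvPolynomial.X i)) F)) (P : MvPolynomial ι ℂ)
    (F : Smooth κ) : opOf P (φ F) = φ (opOf (h P) F) := by
  induction P using MvPolynomial.induction_on generalizing F with
  | C c =>
    have : h (MvPolynomial.C c) = MvPolynomial.C c := h.commutes c
    rw [this, opOf_C, opOf_C, map_smul]
  | add P Q hP hQ => simp [hP, hQ]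
  | mul_X P i hP =>
    rw [opOf_mul_apply, map_mul, opOf_mul_apply, opOf_X, hX, hP]

-- By the Leibniz rule, a factor independent of the variables being differentiated behaves as a
-- scalar.
omit [Fintype κ] [DecidableEq κ] in
theorem opOf_rename_mul (e : κ → ι) (G : Smooth ι) (hG : ∀ k, pd (e k) G = 0)
    (P : MvPolynomial κ ℂ) (F : Smooth ι) :
    opOf (MvPolynomial.rename e P) (G * F) = G * opOf (MvPolynomial.rename e P) F := by
  induction P using MvPolynomial.induction_on generalizing F with
  | C c => simp [MvPolynomial.algHom_C]
  | add P Q hP hQ => simp [hP, hQ, mul_add]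
  | mul_X P i hP =>
    rw [map_mul (MvPolynomial.rename e), opOf_mul_apply, opOf_mul_apply, MvPolynomial.rename_X,
      opOf_X, pd_mul, hG, zero_mul, zero_add, hP]

/-- Chain rule for a map that is affine along the coordinate `i`. -/
theorem pd_pullback (φ : (ι → ℝ) → (κ → ℝ)) (hφ : ContDiff ℝ ∞ φ) (i : ι) (c : κ → ℝ)
    (hc : ∀ w (t : ℝ), φ (w + t • Pi.single i 1) = φ w + t • c) (F : Smooth κ) :
    pd i (pullback φ hφ F) =
      pullback φ hφ (opOf (∑ k, MvPolynomial.C (c k : ℂ) * MvPolynomial.X k) F) := by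
  apply Subtype.ext
  funext w
  have hd : DifferentiableAt ℝ φ w := hφ.differentiable (by simp) w
  have h1 : fderiv ℝ φ w (Pi.single i 1) = c := by
    rw [← hd.lineDeriv_eq_fderiv, lineDeriv]
    simp only [hc]
    have : HasDerivAt (fun t : ℝ => φ w + t • c) ((1 : ℝ) • c) 0 :=
      ((hasDerivAt_id (0 : ℝ)).smul_const c).const_add _
    rw [this.deriv, one_smul]
  have h2 : (pd i (pullback φ hφ F)).1 w = fderiv ℝ F.1 (φ w) c := by
    change fderiv ℝ (fun w => F.1 (φ w)) w (Pi.single i 1) = _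
    have := fderiv_comp w (differentiable_coe F (φ w)) hd
    change fderiv ℝ (F.1 ∘ φ) w (Pi.single i 1) = _
    rw [this, ContinuousLinearMap.comp_apply, h1]
  rw [h2]
  have h3 : c = ∑ k, c k • Pi.single k (1 : ℝ) := by
    ext k
    simp [Finset.sum_apply, Pi.single_apply]
  conv_lhs => rw [h3, map_sum]
  have h4 : opOf (∑ k, MvPolynomial.C (c k : ℂ) * MvPolynomial.X k) F
      = ∑ k, (c k : ℂ) • pd k F := by
    rw [map_sum, LinearMap.sum_apply]
    exact Finset.sum_congr rfl fun k _ => by rw [opOf_mul_apply, opOf_C, opOf_X]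
  rw [h4, map_sum, AddSubmonoidClass.coe_finsetSum, Finset.sum_apply]
  refine Finset.sum_congr rfl fun k _ => ?_
  rw [map_smul]
  change _ = (c k : ℂ) • fderiv ℝ F.1 (φ w) (Pi.single k 1)
  exact (Complex.coe_smul _ _).symm

/-! ### Formal series of differential operators and their exponentials -/

/-- The action of formal power series of polynomials in the derivatives. -/
def act : PowerSeries (MvPolynomial ι ℂ) →+* Module.End ℂ (PowerSeries (Smooth ι)) where
  toFun S :=
    { toFun := fun F => PowerSeries.mk fun n => ∑ q ∈ Finset.HasAntidiagonal.antidiagonal n,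
        opOf (PowerSeries.coeff q.1 S) (PowerSeries.coeff q.2 F)
      map_add' := fun F G => by ext1 n; simp [Finset.sum_add_distrib]
      map_smul' := fun c F => by ext1 n; simp [Finset.smul_sum] }
  map_one' := by
    ext1 F
    ext1 n
    simp only [LinearMap.coe_mk, AddHom.coe_mk, PowerSeries.coeff_mk, Module.End.one_apply]
    rw [Finset.sum_eq_single (0, n)]
    · simp
    · rintro ⟨i, j⟩ hij hne
      have : i ≠ 0 := by
        rintro rfl
        replace hij := Finset.HasAntidiagonal.mem_antidiagonal.1 hij
        exact hne (by simp_all)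
      simp [PowerSeries.coeff_one, this]
    · simp
  map_zero' := by ext1 F; ext1 n; simp
  map_add' S S' := by ext1 F; ext1 n; simp [Finset.sum_add_distrib]
  map_mul' S S' := by
    ext1 F
    ext1 n
    simp only [LinearMap.coe_mk, AddHom.coe_mk, PowerSeries.coeff_mk, Module.End.mul_apply,
      PowerSeries.coeff_mul, map_sum, LinearMap.sum_apply, Finset.sum_sigma', map_mul]
    -- Both sides run over triples of degrees with sum `n`, bracketed differently.
    apply Finset.sum_nbij' (fun ⟨⟨_i, j⟩, ⟨k, l⟩⟩ ↦ ⟨(k, l + j), (l, j)⟩)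
      (fun ⟨⟨i, _j⟩, ⟨k, l⟩⟩ ↦ ⟨(i + k, l), (i, k)⟩) <;>
      rintro ⟨⟨i, j⟩, ⟨k, l⟩⟩ <;> simp +contextual [Finset.mem_sigma, Finset.HasAntidiagonal.mem_antidiagonal] <;> grind

theorem coeff_act (S : PowerSeries (MvPolynomial ι ℂ)) (F : PowerSeries (Smooth ι)) (n : ℕ) :
    PowerSeries.coeff n (act S F) = ∑ q ∈ Finset.HasAntidiagonal.antidiagonal n,
      opOf (PowerSeries.coeff q.1 S) (PowerSeries.coeff q.2 F) := by
  simp [act]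

theorem act_mul_apply (S S' : PowerSeries (MvPolynomial ι ℂ)) (F : PowerSeries (Smooth ι)) :
    act (S * S') F = act S (act S' F) := by
  rw [map_mul]
  rfl

/-- The gradient of an affine map is constant, so the chain rule is a linear substitution of the
polynomial variables. -/
theorem act_pullback (φ : (ι → ℝ) → (κ → ℝ)) (hφ : ContDiff ℝ ∞ φ) (c : ι → κ → ℝ)
    (hc : ∀ i w (t : ℝ), φ (w + t • Pi.single i 1) = φ w + t • c i)
    (S : PowerSeries (MvPolynomial ι ℂ)) (F : PowerSeries (Smooth κ)) :
    act S (mapAlgHom (pullback φ hφ) F) = mapAlgHom (pullback φ hφ)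
      (act (PowerSeries.map (MvPolynomial.aeval fun i =>
        ∑ k, MvPolynomial.C (c i k : ℂ) * MvPolynomial.X k).toRingHom S) F) := by
  ext1 n
  simp only [coeff_act, PowerSeries.mapAlgHom_apply, PowerSeries.coeff_map, map_sum]
  refine Finset.sum_congr rfl fun q _ => ?_
  exact opOf_intertwine (pullback φ hφ).toLinearMap _
    (fun i F => by
      rw [MvPolynomial.aeval_X]
      exact pd_pullback φ hφ i (c i) (hc i) F) _ _

omit [Fintype κ] [DecidableEq κ] in
theorem act_rename_mul (e : κ → ι) (G : PowerSeries (Smooth ι))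
    (hG : ∀ k n, pd (e k) (PowerSeries.coeff n G) = 0)
    (S : PowerSeries (MvPolynomial κ ℂ)) (F : PowerSeries (Smooth ι)) :
    act (PowerSeries.map (MvPolynomial.rename e).toRingHom S) (G * F)
      = G * act (PowerSeries.map (MvPolynomial.rename e).toRingHom S) F := by
  ext1 n
  simp only [coeff_act, PowerSeries.coeff_mul, map_sum, PowerSeries.coeff_map, Finset.mul_sum]
  have : ∀ (a b : ℕ) (H : Smooth ι),
      opOf ((MvPolynomial.rename e).toRingHom (PowerSeries.coeff a S))
        (PowerSeries.coeff b G * H) = PowerSeries.coeff b G *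
      opOf ((MvPolynomial.rename e).toRingHom (PowerSeries.coeff a S)) H := fun a b H =>
    opOf_rename_mul e _ (fun k => hG k b) _ H
  simp only [this, Finset.sum_sigma']
  apply Finset.sum_nbij' (fun ⟨⟨i, _j⟩, ⟨k, l⟩⟩ ↦ ⟨(k, i + l), (i, l)⟩)
    (fun ⟨⟨i, _j⟩, ⟨k, l⟩⟩ ↦ ⟨(k, i + l), (i, l)⟩) <;>
    rintro ⟨⟨i, j⟩, ⟨k, l⟩⟩ <;> simp +contextual [Finset.mem_sigma, Finset.HasAntidiagonal.mem_antidiagonal] <;> grind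

/-- The symbol `exp(ħ P)` of the formal exponential of `ħ P(∂)`. -/
def expS (P : MvPolynomial ι ℂ) : PowerSeries (MvPolynomial ι ℂ) :=
  PowerSeries.rescale P (PowerSeries.exp _)

omit [Fintype ι] [DecidableEq ι] in
theorem coeff_expS (P : MvPolynomial ι ℂ) (n : ℕ) :
    PowerSeries.coeff n (expS P) = MvPolynomial.C (1 / (n.factorial : ℂ)) * P ^ n := by
  rw [expS, PowerSeries.coeff_rescale, PowerSeries.coeff_exp, mul_comm]
  congr 1
  rw [IsScalarTower.algebraMap_apply ℚ ℂ (MvPolynomial ι ℂ), MvPolynomial.algebraMap_eq]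
  simp

omit [Fintype ι] [DecidableEq ι] in
theorem expS_add (P Q : MvPolynomial ι ℂ) : expS (P + Q) = expS P * expS Q :=
  (PowerSeries.exp_mul_exp_eq_exp_add P Q).symm

omit [Fintype ι] [DecidableEq ι] in
theorem expS_zero : expS (0 : MvPolynomial ι ℂ) = 1 := by
  simp [expS]

omit [Fintype ι] [DecidableEq ι] [Fintype κ] [DecidableEq κ] in
theorem map_expS (h : MvPolynomial ι ℂ →ₐ[ℂ] MvPolynomial κ ℂ) (P : MvPolynomial ι ℂ) :
    PowerSeries.map h.toRingHom (expS P) = expS (h P) := by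
  ext1 n
  rw [PowerSeries.coeff_map, coeff_expS, coeff_expS]
  change h _ = _
  rw [map_mul, map_pow, MvPolynomial.algHom_C]
  rfl

end Operators

open MvPolynomial (X C)

variable {N : ℕ}

/-! ### Products of Weyl operators -/

/-- The polynomial of `∑_j ∂_{y_j} ∂_{p_j}`. -/
def crossPoly (N : ℕ) : MvPolynomial (TripleIdx N) ℂ :=
  ∑ j : Fin N, X (Sum.inr (Sum.inl j)) * X (Sum.inr (Sum.inr j))

theorem opOf_crossPoly : opOf (crossPoly N) = crossLaplacian N := by
  simp only [crossPoly, crossLaplacian, map_sum, map_mul, opOf_X]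
  rfl

/-- The sums over degrees in the definition form the Cauchy product of the exponential series, the
symbol and the amplitude. -/
theorem weylOp_apply (A : Symbol N) (u : Wave N) (p₀ : Fin N → ℝ) :
    weylOp A u p₀ = mapAlgHom (pullback (diagonalMap p₀) (contDiff_diagonalMap p₀))
      (act (expS (C (-Complex.I) * crossPoly N))
        (mapAlgHom (pullback (midpointMap N) (contDiff_midpointMap N)) A *
          mapAlgHom (pullback (middleMap N) (contDiff_middleMap N)) (u p₀))) := by
  ext1 n
  simp only [PowerSeries.mapAlgHom_apply, PowerSeries.coeff_map, coeff_act, coeff_expS, map_sum]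
  have h : weylOp A u p₀ = PowerSeries.mk fun n =>
    ∑ q ∈ Finset.HasAntidiagonal.antidiagonal n, ∑ r ∈ Finset.HasAntidiagonal.antidiagonal q.2,
      weylTerm q.1 (PowerSeries.coeff r.1 A) p₀ (PowerSeries.coeff r.2 (u p₀)) := rfl
  rw [h, PowerSeries.coeff_mk]
  refine Finset.sum_congr rfl fun q _ => ?_
  rw [PowerSeries.coeff_mul, map_sum, map_sum]
  refine Finset.sum_congr rfl fun r _ => ?_
  rw [weylTerm, mul_pow, ← mul_assoc, ← MvPolynomial.C_pow, ← MvPolynomial.C_mul, opOf_mul_apply, opOf_C, map_pow,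
    opOf_crossPoly]
  simp only [PowerSeries.coeff_map]
  change _ = pullback (diagonalMap p₀) (contDiff_diagonalMap p₀) _
  rw [map_smul]
  congr 1
  rw [one_div, inv_mul_eq_div]

/-- The projection to the `v`-th copy of phase space. -/
def copyMap {V : ℕ} (v : Fin V) (w : Fin V × PhaseIdx N → ℝ) : PhaseIdx N → ℝ := fun μ => w (v, μ)

theorem contDiff_copyMap {V : ℕ} (v : Fin V) : ContDiff ℝ ∞ (copyMap (N := N) v) := by
  unfold copyMap
  fun_prop

/-- The function `F_1(z_1) ⋯ F_V(z_V)` on `V` copies of phase space. -/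
def tens {V : ℕ} (F : Fin V → Symbol N) : PowerSeries (Smooth (Fin V × PhaseIdx N)) :=
  ∏ v, mapAlgHom (pullback (copyMap v) (contDiff_copyMap v)) (F v)

/-- The map `x ↦ (z_v)` with `z_v = (x, p₀)` for all `v`. -/
def waveMap (V : ℕ) (p₀ : Fin N → ℝ) (x : Fin N → ℝ) : Fin V × PhaseIdx N → ℝ :=
  fun k => Sum.elim x p₀ k.2

theorem contDiff_waveMap (V : ℕ) (p₀ : Fin N → ℝ) : ContDiff ℝ ∞ (waveMap V p₀) := by
  rw [contDiff_pi]
  rintro ⟨v, j | j⟩ <;> simp only [waveMap, Sum.elim_inl, Sum.elim_inr] <;> fun_prop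

/-- The polynomial of `∑_j (½ ∑_v ∂_{x_{v,j}} ∂_{p_{v,j}} + ∑_{v<w} ∂_{p_{v,j}} ∂_{x_{w,j}})`. -/
def wavePoly (N V : ℕ) : MvPolynomial (Fin V × PhaseIdx N) ℂ :=
  ∑ j : Fin N, (C (1 / 2) * ∑ v, X (v, Sum.inl j) * X (v, Sum.inr j) +
    ∑ v, ∑ w, if v < w then X (v, Sum.inr j) * X (w, Sum.inl j) else 0)

/-- The first sum is what `∑_j ∂_{y_j} ∂_{p_j}` becomes along `composeMap`: moving `y` moves `x_0`
at half speed and every later `x_v` at full speed, while `p` moves only `p_0`. -/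
theorem wavePoly_succ (V : ℕ) : wavePoly N (V + 1) =
    (∑ j : Fin N, (C (1 / 2) * X (0, Sum.inl j) + ∑ v : Fin V, X (v.succ, Sum.inl j)) *
      X (0, Sum.inr j)) + MvPolynomial.rename (Prod.map Fin.succ id) (wavePoly N V) := by
  simp only [wavePoly, map_sum, map_add, map_mul, MvPolynomial.rename_X, MvPolynomial.rename_C,
    Prod.map_apply, id, apply_ite (MvPolynomial.rename _), map_zero, Fin.sum_univ_succ,
    Fin.succ_lt_succ_iff, Fin.succ_pos, if_true, if_false, Fin.not_lt_zero,
    zero_add]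
  rw [← Finset.sum_add_distrib]
  refine Finset.sum_congr rfl fun j _ => ?_
  rw [add_mul, Finset.sum_mul]
  simp only [mul_comm (X (_ , Sum.inr j))]
  ring

/-- The map `(x, y, p) ↦ (z_v)` with `z_0 = ((x + y) / 2, p)` and `z_v = (y, p₀)` otherwise. -/
def composeMap (V : ℕ) (p₀ : Fin N → ℝ) (w : TripleIdx N → ℝ) : Fin (V + 1) × PhaseIdx N → ℝ :=
  fun k => Fin.cases (motive := fun _ => PhaseIdx N → ℝ) (midpointMap N w)
    (fun _ => Sum.elim (middleMap N w) p₀) k.1 k.2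

theorem contDiff_composeMap (V : ℕ) (p₀ : Fin N → ℝ) : ContDiff ℝ ∞ (composeMap V p₀) := by
  rw [contDiff_pi]
  rintro ⟨v, j | j⟩ <;> refine Fin.cases ?_ (fun v => ?_) v <;>
    simp only [composeMap, Fin.cases_zero, Fin.cases_succ, midpointMap, middleMap, Sum.elim_inl,
      Sum.elim_inr] <;> fun_prop

/-- The projection that forgets the first copy of phase space. -/
def tailMap (V : ℕ) (w : Fin (V + 1) × PhaseIdx N → ℝ) : Fin V × PhaseIdx N → ℝ :=
  fun k => w (k.1.succ, k.2)

theorem contDiff_tailMap (V : ℕ) : ContDiff ℝ ∞ (tailMap (N := N) V) := by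
  unfold tailMap
  fun_prop

theorem tens_succ {V : ℕ} (F : Fin (V + 1) → Symbol N) :
    tens F = mapAlgHom (pullback (copyMap 0) (contDiff_copyMap 0)) (F 0) *
      mapAlgHom (pullback (tailMap V) (contDiff_tailMap V)) (tens fun v => F v.succ) := by
  rw [tens, Fin.prod_univ_succ, tens, map_prod]
  congr 1

/-- The gradient of `composeMap`. -/
def composeGrad (V : ℕ) (i : TripleIdx N) (k : Fin (V + 1) × PhaseIdx N) : ℝ :=
  composeMap V 0 (Pi.single i 1) k

/-- `p₀` enters only the constant part of this affine map, hence the gradient may be computed with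
`p₀ = 0`. -/
theorem composeMap_add (V : ℕ) (p₀ : Fin N → ℝ) (i : TripleIdx N) (w : TripleIdx N → ℝ) (t : ℝ) :
    composeMap V p₀ (w + t • Pi.single i 1) = composeMap V p₀ w + t • composeGrad V i := by
  refine funext ?_
  rintro ⟨v, j | j⟩ <;> refine Fin.cases ?_ (fun v => ?_) v <;>
    (simp [composeMap, composeGrad, midpointMap, middleMap]; try ring)

theorem sum_composeGrad_y (V : ℕ) (j : Fin N) :
    (∑ k, C (composeGrad V (Sum.inr (Sum.inl j)) k : ℂ) * X k
        : MvPolynomial (Fin (V + 1) × PhaseIdx N) ℂ) =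
      C (1 / 2) * X (0, Sum.inl j) + ∑ v : Fin V, X (v.succ, Sum.inl j) := by
  rw [Fintype.sum_prod_type, Fin.sum_univ_succ]
  simp only [Fintype.sum_sum_type, composeGrad, composeMap, Fin.cases_zero, Fin.cases_succ,
    midpointMap, middleMap, Sum.elim_inl, Sum.elim_inr]
  congr 1
  · rw [Finset.sum_eq_single j]
    · simp
    · intro b _ hb
      simp [hb]
    · simp
  · refine Finset.sum_congr rfl fun v _ => ?_
    rw [Finset.sum_eq_single j]
    · simp
    · intro b _ hb
      simp [hb]
    · simp

theorem sum_composeGrad_p (V : ℕ) (j : Fin N) :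
    (∑ k, C (composeGrad V (Sum.inr (Sum.inr j)) k : ℂ) * X k
        : MvPolynomial (Fin (V + 1) × PhaseIdx N) ℂ) = X (0, Sum.inr j) := by
  rw [Fintype.sum_prod_type, Fin.sum_univ_succ]
  simp only [Fintype.sum_sum_type, composeGrad, composeMap, Fin.cases_zero, Fin.cases_succ,
    midpointMap, middleMap, Sum.elim_inl, Sum.elim_inr]
  rw [Finset.sum_eq_zero (s := Finset.univ (α := Fin V)) (by intros; simp), add_zero,
    Finset.sum_eq_zero (by intros; simp), zero_add, Finset.sum_eq_single j]
  · simp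
  · intro b _ hb
    simp [hb]
  · simp

/-- The product `Â_1 ⋯ Â_V`. -/
def weylProd {V : ℕ} (F : Fin V → Symbol N) : Module.End ℂ (Wave N) :=
  (List.ofFn fun v => weylOp (F v)).prod

theorem pd_copyMap_ne {V : ℕ} {v w : Fin V} (h : w ≠ v) (μ : PhaseIdx N) (F : Smooth (PhaseIdx N)) :
    pd (w, μ) (pullback (copyMap v) (contDiff_copyMap v) F) = 0 := by
  rw [pd_pullback (copyMap v) (contDiff_copyMap v) (w, μ) 0]
  · simp
  · intro x t
    funext ν
    simp [copyMap, h.symm]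

theorem pd_copyMap_self {V : ℕ} (v : Fin V) (μ : PhaseIdx N) (F : Smooth (PhaseIdx N)) :
    pd (v, μ) (pullback (copyMap v) (contDiff_copyMap v) F)
      = pullback (copyMap v) (contDiff_copyMap v) (pd μ F) := by
  rw [pd_pullback (copyMap v) (contDiff_copyMap v) (v, μ) (Pi.single μ 1)]
  · rw [Finset.sum_eq_single μ]
    · simp
    · intro b _ hb
      simp [hb]
    · simp
  · intro x t
    funext ν
    simp [copyMap, Pi.single_apply]

/-- The derivatives concern only the later copies, so the first factor passes through; the
substitution dual to `tailMap` undoes the renaming by `Fin.succ`. -/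
theorem act_tail_tens {V : ℕ} (F : Fin (V + 1) → Symbol N)
    (S : PowerSeries (MvPolynomial (Fin V × PhaseIdx N) ℂ)) :
    act (PowerSeries.map (MvPolynomial.rename (Prod.map Fin.succ id)).toRingHom S) (tens F) =
      mapAlgHom (pullback (copyMap 0) (contDiff_copyMap 0)) (F 0) *
        mapAlgHom (pullback (tailMap V) (contDiff_tailMap V)) (act S (tens fun v => F v.succ)) := by
  rw [tens_succ, act_rename_mul]
  · rw [act_pullback (tailMap V) (contDiff_tailMap V)
      (fun i k => (Pi.single i (1 : ℝ) : Fin (V + 1) × PhaseIdx N → ℝ) (k.1.succ, k.2))]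
    · congr 4
      ext1 n
      rw [PowerSeries.coeff_map, PowerSeries.coeff_map]
      change MvPolynomial.aeval _ (MvPolynomial.rename _ _) = _
      rw [MvPolynomial.aeval_rename]
      convert MvPolynomial.aeval_X_left_apply _
      refine funext fun k => ?_
      rw [Function.comp_apply, Finset.sum_eq_single k]
      · simp [Prod.map]
      · rintro ⟨v, μ⟩ _ hb
        rw [Pi.single_apply, if_neg]
        · simp
        · rintro h
          apply hb
          simpa [Prod.ext_iff] using h
      · simp
    · intro i w t
      rfl
  · rintro ⟨v, μ⟩ n
    rw [PowerSeries.mapAlgHom_apply, PowerSeries.coeff_map]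
    exact pd_copyMap_ne (Fin.succ_ne_zero v) _ _

/-- Induction on the number of factors: the leftmost operator acts on the amplitude produced by the
others, and the two exponents add up by `wavePoly_succ`. -/
theorem weylProd_one {V : ℕ} (F : Fin V → Symbol N) (p₀ : Fin N → ℝ) :
    weylProd F (fun _ => 1) p₀ = mapAlgHom (pullback (waveMap V p₀) (contDiff_waveMap V p₀))
      (act (expS (C (-Complex.I) * wavePoly N V)) (tens F)) := by
  induction V with
  | zero =>
    have : wavePoly N 0 = 0 := by simp [wavePoly]
    rw [this, mul_zero, expS_zero, map_one]
    simp [weylProd, tens]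
  | succ V ih =>
    have h1 : weylProd F (fun _ => 1) p₀
        = weylOp (F 0) (weylProd (fun v => F v.succ) fun _ => 1) p₀ := by
      rw [weylProd, List.ofFn_succ, List.prod_cons]
      rfl
    rw [h1, weylOp_apply, ih]
    set W := act (expS (C (-Complex.I) * wavePoly N V)) (tens fun v => F v.succ) with hW
    -- Both factors are pulled back along the single map `composeMap`, through which the outer
    -- exponential can then be moved.
    have h2 : mapAlgHom (pullback (midpointMap N) (contDiff_midpointMap N)) (F 0) *
        mapAlgHom (pullback (middleMap N) (contDiff_middleMap N))
          (mapAlgHom (pullback (waveMap V p₀) (contDiff_waveMap V p₀)) W) =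
        mapAlgHom (pullback (composeMap V p₀) (contDiff_composeMap V p₀))
          (mapAlgHom (pullback (copyMap 0) (contDiff_copyMap 0)) (F 0) *
            mapAlgHom (pullback (tailMap V) (contDiff_tailMap V)) W) := by
      rw [map_mul]
      congr 1
    rw [h2, hW, ← act_tail_tens,
      act_pullback _ (contDiff_composeMap V p₀) (composeGrad V) (composeMap_add V p₀), map_expS,
      map_expS, ← act_mul_apply, ← expS_add]
    have h3 : MvPolynomial.aeval
        (fun i => ∑ k, C (composeGrad V i k : ℂ) * X k : TripleIdx N →
          MvPolynomial (Fin (V + 1) × PhaseIdx N) ℂ) (C (-Complex.I) * crossPoly N) +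
        MvPolynomial.rename (Prod.map Fin.succ id) (C (-Complex.I) * wavePoly N V) =
        C (-Complex.I) * wavePoly N (V + 1) := by
      rw [wavePoly_succ, map_mul, map_mul, MvPolynomial.rename_C, MvPolynomial.algHom_C,
        MvPolynomial.algebraMap_eq, mul_add, crossPoly, map_sum]
      simp only [map_mul, MvPolynomial.aeval_X, sum_composeGrad_y, sum_composeGrad_p]
    rw [h3]
    ext1 n
    simp only [PowerSeries.mapAlgHom_apply, PowerSeries.coeff_map]
    generalize PowerSeries.coeff n (act _ (tens F)) = G
    apply Subtype.ext
    funext x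
    change G.1 _ = G.1 _
    -- On the diagonal `y = x`, `p = p₀` the midpoint is `x`, so all copies coincide.
    refine congrArg G.1 (funext ?_)
    rintro ⟨v, j | j⟩ <;> refine Fin.cases ?_ (fun v => ?_) v <;>
      simp [composeMap, diagonalMap, midpointMap, middleMap, waveMap]

/-! ### The star product of several symbols -/

/-- The diagonal embedding of phase space into `V` copies of phase space. -/
def copiesMap (V : ℕ) (z : PhaseIdx N → ℝ) : Fin V × PhaseIdx N → ℝ := fun k => z k.2

theorem contDiff_copiesMap (V : ℕ) : ContDiff ℝ ∞ (copiesMap (N := N) V) := by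
  unfold copiesMap
  fun_prop

/-- The edges that a labeled graph with `V` vertices may have. -/
abbrev Edge (V : ℕ) : Type := {t : Finset (Fin V) // t.card = 2}

namespace Edge

variable {V : ℕ}

theorem nonempty (t : Edge V) : t.1.Nonempty := by
  rw [← Finset.card_pos, t.2]
  norm_num

/-- The smaller end point. -/
def tail (t : Edge V) : Fin V := t.1.min' t.nonempty

/-- The larger end point. -/
def head (t : Edge V) : Fin V := t.1.max' t.nonempty

theorem tail_lt_head (t : Edge V) : t.tail < t.head := by
  apply Finset.min'_lt_max'_of_card
  rw [t.2]
  norm_num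

theorem eq_pair (t : Edge V) : t.1 = {t.tail, t.head} := by
  symm
  apply Finset.eq_of_subset_of_card_le
  · intro v hv
    rcases Finset.mem_insert.1 hv with rfl | hv
    · exact Finset.min'_mem _ _
    · rw [Finset.mem_singleton.1 hv]
      exact Finset.max'_mem _ _
  · rw [t.2, Finset.card_pair t.tail_lt_head.ne]

/-- The edge that joins `v` and `w`. -/
def mk {v w : Fin V} (h : v ≠ w) : Edge V := ⟨{v, w}, Finset.card_pair h⟩

theorem tail_mk {v w : Fin V} (h : v < w) : (mk h.ne).tail = v := by
  simp [tail, mk, Finset.min'_insert, h.le]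

theorem head_mk {v w : Fin V} (h : v < w) : (mk h.ne).head = w := by
  simp [head, mk, Finset.max'_insert, h.le]

theorem sum_eq {M : Type*} [AddCommMonoid M] (g : Fin V → Fin V → M) :
    ∑ t : Edge V, g t.tail t.head = ∑ v, ∑ w, if v < w then g v w else 0 := by
  rw [← Fintype.sum_prod_type' fun v w => if v < w then g v w else 0, ← Finset.sum_filter]
  refine Finset.sum_bij' (fun t _ => (t.tail, t.head))
    (fun k hk => mk (Finset.mem_filter.1 hk).2.ne) ?_ ?_ ?_ ?_ ?_
  · intro t _
    simpa using t.tail_lt_head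
  · simp
  · intro t _
    exact Subtype.ext t.eq_pair.symm
  · intro k hk
    have := (Finset.mem_filter.1 hk).2
    exact Prod.ext (tail_mk this) (head_mk this)
  · simp

end Edge

/-- The polynomial of `∑_{v<w} J^{μν} ∂_{v,μ} ∂_{w,ν}`. -/
def edgePoly (N V : ℕ) : MvPolynomial (Fin V × PhaseIdx N) ℂ :=
  ∑ t : Edge V, ∑ μ, ∑ ν, C (poissonTensor N μ ν) * (X (t.tail, μ) * X (t.head, ν))

theorem sum_poissonTensor {V : ℕ} (v w : Fin V) :
    (∑ μ, ∑ ν, C (poissonTensor N μ ν) * (X (v, μ) * X (w, ν)) :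
        MvPolynomial (Fin V × PhaseIdx N) ℂ) =
      ∑ j : Fin N, (X (v, Sum.inl j) * X (w, Sum.inr j) - X (v, Sum.inr j) * X (w, Sum.inl j)) := by
  simp only [Fintype.sum_sum_type, poissonTensor, Matrix.fromBlocks_apply₁₁,
    Matrix.fromBlocks_apply₁₂, Matrix.fromBlocks_apply₂₁, Matrix.fromBlocks_apply₂₂,
    Matrix.zero_apply, map_zero, zero_mul, Finset.sum_const_zero, zero_add, add_zero,
    Matrix.neg_apply, Matrix.one_apply]
  rw [Finset.sum_sub_distrib, sub_eq_add_neg, ← Finset.sum_neg_distrib]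
  congr 1 <;> refine Finset.sum_congr rfl fun j _ => ?_ <;> rw [Finset.sum_eq_single j] <;>
    simp +contextual [eq_comm]

theorem edgePoly_eq (V : ℕ) : edgePoly N V = ∑ j : Fin N, ∑ v, ∑ w, if v < w then
    X (v, Sum.inl j) * X (w, Sum.inr j) - X (v, Sum.inr j) * X (w, Sum.inl j) else 0 := by
  simp only [edgePoly, sum_poissonTensor]
  rw [Finset.sum_comm]
  exact Finset.sum_congr rfl fun j _ => Edge.sum_eq fun v w =>
    (X (v, Sum.inl j) * X (w, Sum.inr j) - X (v, Sum.inr j) * X (w, Sum.inl j) :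
      MvPolynomial (Fin V × PhaseIdx N) ℂ)

/-- The product `F_1 ⋆ ⋯ ⋆ F_V` of symbols. -/
def star {V : ℕ} (F : Fin V → Symbol N) : Symbol N :=
  mapAlgHom (pullback (copiesMap V) (contDiff_copiesMap V))
    (act (expS (C (Complex.I / 2) * edgePoly N V)) (tens F))

/-- The polynomial of `∑_j ∂_{x_j} ∂_{p_j}`. -/
def leftPoly (N : ℕ) : MvPolynomial (PhaseIdx N) ℂ := ∑ j : Fin N, X (Sum.inl j) * X (Sum.inr j)

theorem sum_sum_eq_diag_add {R : Type*} [CommRing R] {V : ℕ} (a b : Fin V → R) :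
    (∑ v, a v) * ∑ w, b w = ∑ v, a v * b v + ∑ v, ∑ w, if v < w then a v * b w + a w * b v else 0 := by
  rw [Finset.sum_mul_sum]
  have h : ∀ v w : Fin V, a v * b w = (if v = w then a v * b w else 0) +
      ((if v < w then a v * b w else 0) + if w < v then a v * b w else 0) := by
    intro v w
    rcases lt_trichotomy v w with h | h | h
    · simp [h, h.ne, h.not_gt]
    · simp [h]
    · simp [h, h.ne', h.not_gt]
  simp only [ite_add_zero]
  rw [Finset.sum_congr rfl fun v _ => Finset.sum_congr rfl fun w _ => h v w]
  simp only [Finset.sum_add_distrib, Finset.sum_ite_eq, Finset.mem_univ, if_true]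
  congr 2
  rw [Finset.sum_comm]

/-- For `v < w`, the operator `∂_{x_v} ∂_{p_w}` cancels between the two terms, whereas the two
halves of `∂_{p_v} ∂_{x_w}` add up. The diagonal part comes from the first term alone. -/
theorem aeval_leftPoly_add_edgePoly (V : ℕ) :
    C (-(Complex.I / 2)) * (∑ j : Fin N, (∑ v : Fin V, X (v, Sum.inl j)) *
      ∑ v : Fin V, X (v, Sum.inr j)) + C (Complex.I / 2) * edgePoly N V
      = C (-Complex.I) * wavePoly N V := by
  rw [edgePoly_eq, wavePoly, Finset.mul_sum, Finset.mul_sum, Finset.mul_sum,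
    ← Finset.sum_add_distrib]
  refine Finset.sum_congr rfl fun j _ => ?_
  rw [sum_sum_eq_diag_add]
  have h1 : (C (-(Complex.I / 2)) : MvPolynomial (Fin V × PhaseIdx N) ℂ)
      = C (-Complex.I) * C (1 / 2) := by
    rw [← map_mul]
    congr 1
    ring
  have h2 : (C (Complex.I / 2) : MvPolynomial (Fin V × PhaseIdx N) ℂ)
      = - (C (-Complex.I) * C (1 / 2)) := by
    rw [← h1, ← map_neg, neg_neg]
  have h3 : (C (1 / 2) + C (1 / 2) : MvPolynomial (Fin V × PhaseIdx N) ℂ) = 1 := by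
    rw [← map_add, ← map_one C]
    congr 1
    norm_num
  rw [h1, h2, mul_add, mul_add, neg_mul, mul_assoc, mul_assoc, mul_assoc, add_assoc]
  congr 1
  rw [← sub_eq_add_neg, ← mul_sub]
  congr 1
  rw [← mul_sub, ← Finset.sum_sub_distrib, Finset.mul_sum]
  refine Finset.sum_congr rfl fun v _ => ?_
  rw [← Finset.sum_sub_distrib, Finset.mul_sum]
  refine Finset.sum_congr rfl fun w _ => ?_
  split_ifs
  · linear_combination (X (w, Sum.inl j) * X (v, Sum.inr j)) * h3
  · simp

/-- The symbol for the ordering with all `x` to the left. -/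
def leftSymbol (S : Symbol N) : Symbol N := act (expS (C (-(Complex.I / 2)) * leftPoly N)) S

/-- The exponential with the opposite exponent is an inverse. -/
theorem leftSymbol_injective : Function.Injective (leftSymbol (N := N)) := by
  apply Function.LeftInverse.injective (g := act (expS (C (Complex.I / 2) * leftPoly N)))
  intro S
  rw [leftSymbol, ← act_mul_apply, ← expS_add, ← add_mul, ← map_add, add_neg_cancel, map_zero,
    zero_mul, expS_zero, map_one]
  rfl

theorem copiesMap_add (V : ℕ) (i : PhaseIdx N) (w : PhaseIdx N → ℝ) (t : ℝ) :
    copiesMap V (w + t • Pi.single i 1) = copiesMap V w + t • copiesMap V (Pi.single i 1) := rfl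

theorem sum_copiesMap (V : ℕ) (i : PhaseIdx N) :
    (∑ k, C ((copiesMap V (Pi.single i (1 : ℝ)) k : ℝ) : ℂ) * X k
      : MvPolynomial (Fin V × PhaseIdx N) ℂ) = ∑ v, X (v, i) := by
  rw [Fintype.sum_prod_type]
  refine Finset.sum_congr rfl fun v _ => ?_
  rw [Finset.sum_eq_single i]
  · simp [copiesMap]
  · intro b _ hb
    simp [copiesMap, hb]
  · simp

/-- Restricted to the diagonal, `∂_i` becomes the sum of the `∂_{v,i}` over all copies, so the
ordering exponential merges with the Moyal exponential. -/
theorem leftSymbol_star {V : ℕ} (F : Fin V → Symbol N) :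
    leftSymbol (star F) = mapAlgHom (pullback (copiesMap V) (contDiff_copiesMap V))
      (act (expS (C (-Complex.I) * wavePoly N V)) (tens F)) := by
  have h : MvPolynomial.aeval (fun i => ∑ k, C ((copiesMap V (Pi.single i (1 : ℝ)) k : ℝ) : ℂ) * X k)
      (C (-(Complex.I / 2)) * leftPoly N) = (C (-(Complex.I / 2)) *
        (∑ j : Fin N, (∑ v : Fin V, X (v, Sum.inl j)) * ∑ v : Fin V, X (v, Sum.inr j)) :
          MvPolynomial (Fin V × PhaseIdx N) ℂ) := by
    rw [map_mul, MvPolynomial.algHom_C, MvPolynomial.algebraMap_eq, leftPoly, map_sum]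
    simp only [map_mul, MvPolynomial.aeval_X, sum_copiesMap]
  rw [leftSymbol, star, act_pullback _ _ _ (copiesMap_add V), map_expS, ← act_mul_apply,
    ← expS_add, h, aeval_leftPoly_add_edgePoly]

/-! ### Symbols read off from the action on plane waves -/

/-- The embedding `x ↦ (x, p₀)`. -/
def momentumMap (p₀ : Fin N → ℝ) (x : Fin N → ℝ) : PhaseIdx N → ℝ := Sum.elim x p₀

theorem contDiff_momentumMap (p₀ : Fin N → ℝ) : ContDiff ℝ ∞ (momentumMap p₀) := by
  rw [contDiff_pi]
  rintro (j | j) <;> simp only [momentumMap, Sum.elim_inl, Sum.elim_inr] <;> fun_prop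

/-- The constant amplitude at every momentum. -/
def oneWave (N : ℕ) : Wave N := fun _ => 1

/-- The operator `W` maps `e^{i p₀·x/ħ}` to what an operator with Weyl symbol `S` maps it to. -/
def HasSymbol (W : Module.End ℂ (Wave N)) (S : Symbol N) : Prop :=
  ∀ p₀, W (oneWave N) p₀ =
    mapAlgHom (pullback (momentumMap p₀) (contDiff_momentumMap p₀)) (leftSymbol S)

theorem HasSymbol.unique {W : Module.End ℂ (Wave N)} {S S' : Symbol N} (h : HasSymbol W S)
    (h' : HasSymbol W S') : S = S' := by
  apply leftSymbol_injective
  ext1 n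
  apply Subtype.ext
  funext z
  -- The plane wave whose momentum is the `p`-part of `z`, evaluated at the `x`-part of `z`, detects
  -- the value at `z`.
  have := congrArg (fun F => (PowerSeries.coeff n F).1 fun j => z (Sum.inl j))
    ((h fun j => z (Sum.inr j)).symm.trans (h' fun j => z (Sum.inr j)))
  simp only [PowerSeries.mapAlgHom_apply, PowerSeries.coeff_map] at this
  have hz : momentumMap (fun j => z (Sum.inr j)) (fun j => z (Sum.inl j)) = z := by
    refine funext ?_
    rintro (j | j) <;> rfl
  change (PowerSeries.coeff n (leftSymbol S)).1 _ = (PowerSeries.coeff n (leftSymbol S')).1 _ at this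
  rwa [hz] at this

theorem hasSymbol_weylProd {V : ℕ} (F : Fin V → Symbol N) : HasSymbol (weylProd F) (star F) := by
  intro p₀
  refine (weylProd_one F p₀).trans ?_
  rw [leftSymbol_star]
  rfl

theorem star_single (B : Symbol N) : star (fun _ : Fin 1 => B) = B := by
  have h : edgePoly N 1 = 0 := by simp [edgePoly_eq]
  rw [star, h, mul_zero, expS_zero, map_one, Module.End.one_apply, tens, Fin.prod_univ_one]
  rfl

theorem hasSymbol_weylOp (B : Symbol N) : HasSymbol (weylOp B) B := by
  have := hasSymbol_weylProd fun _ : Fin 1 => B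
  rw [star_single] at this
  simpa [weylProd] using this

theorem HasSymbol.add {W W' : Module.End ℂ (Wave N)} {S S' : Symbol N} (h : HasSymbol W S)
    (h' : HasSymbol W' S') : HasSymbol (W + W') (S + S') := by
  intro p₀
  rw [leftSymbol, map_add, map_add]
  change W _ p₀ + W' _ p₀ = _
  rw [h, h']
  rfl

theorem HasSymbol.zero : HasSymbol (0 : Module.End ℂ (Wave N)) 0 := by
  intro p₀
  rw [leftSymbol, map_zero, map_zero]
  rfl

theorem HasSymbol.smul {W : Module.End ℂ (Wave N)} {S : Symbol N} (c : ℂ) (h : HasSymbol W S) :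
    HasSymbol (c • W) (c • S) := by
  intro p₀
  rw [leftSymbol, map_smul, map_smul]
  change c • W _ p₀ = _
  rw [h]
  rfl

theorem HasSymbol.sum {α : Type*} (s : Finset α) {W : α → Module.End ℂ (Wave N)}
    {S : α → Symbol N} (h : ∀ a ∈ s, HasSymbol (W a) (S a)) :
    HasSymbol (∑ a ∈ s, W a) (∑ a ∈ s, S a) := by
  classical
  induction s using Finset.induction_on with
  | empty => simpa using HasSymbol.zero
  | insert a s ha ih =>
    rw [Finset.sum_insert ha, Finset.sum_insert ha]
    exact (h a (Finset.mem_insert_self a s)).add (ih fun b hb => h b (Finset.mem_insert_of_mem hb))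

/-! ### Constant symbols -/

/-- A formal power series in `ħ` as a constant formal function. -/
def const (ι : Type) [Fintype ι] : PowerSeries ℂ →+* PowerSeries (Smooth ι) :=
  PowerSeries.map (algebraMap ℂ (Smooth ι))

theorem coeff_const_mul {ι : Type} [Fintype ι] (c : PowerSeries ℂ) (F : PowerSeries (Smooth ι))
    (n : ℕ) : PowerSeries.coeff n (const ι c * F) = ∑ q ∈ Finset.HasAntidiagonal.antidiagonal n,
      PowerSeries.coeff q.1 c • PowerSeries.coeff q.2 F := by
  simp only [PowerSeries.coeff_mul, const, PowerSeries.coeff_map, Algebra.smul_def]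

theorem mapAlgHom_const {ι κ : Type} [Fintype ι] [Fintype κ] (φ : Smooth ι →ₐ[ℂ] Smooth κ)
    (c : PowerSeries ℂ) : mapAlgHom φ (const ι c) = const κ c := by
  ext1 n
  simp [const, PowerSeries.mapAlgHom_apply]

theorem act_const_mul {ι : Type} [Fintype ι] [DecidableEq ι]
    (S : PowerSeries (MvPolynomial ι ℂ)) (c : PowerSeries ℂ) (F : PowerSeries (Smooth ι)) :
    act S (const ι c * F) = const ι c * act S F := by
  ext1 n
  simp only [coeff_act, coeff_const_mul, map_sum, map_smul, Finset.smul_sum, Finset.sum_sigma']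
  apply Finset.sum_nbij' (fun ⟨⟨i, _j⟩, ⟨k, l⟩⟩ ↦ ⟨(k, i + l), (i, l)⟩)
    (fun ⟨⟨i, _j⟩, ⟨k, l⟩⟩ ↦ ⟨(k, i + l), (i, l)⟩) <;>
      rintro ⟨⟨i, j⟩, ⟨k, l⟩⟩ <;>
      simp +contextual [Finset.mem_sigma, Finset.HasAntidiagonal.mem_antidiagonal] <;> grind

/-- Multiplication of the amplitudes by a formal power series in `ħ`. -/
def mulConst (N : ℕ) : PowerSeries ℂ →+* Module.End ℂ (Wave N) where
  toFun c :=
    { toFun := fun u p₀ => const (Fin N) c * u p₀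
      map_add' := fun u v => by funext p₀; exact mul_add _ _ _
      map_smul' := fun a u => by funext p₀; exact mul_smul_comm a (const (Fin N) c) (u p₀) }
  map_one' := by ext1 u; funext p₀; simp
  map_mul' c d := by ext1 u; funext p₀; simp [mul_assoc]
  map_zero' := by ext1 u; funext p₀; simp
  map_add' c d := by ext1 u; funext p₀; simp [add_mul]

theorem mulConst_apply (c : PowerSeries ℂ) (u : Wave N) (p₀ : Fin N → ℝ) :
    mulConst N c u p₀ = const (Fin N) c * u p₀ := rfl

theorem HasSymbol.mulConst_mul {W : Module.End ℂ (Wave N)} {S : Symbol N} (c : PowerSeries ℂ)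
    (h : HasSymbol W S) : HasSymbol (mulConst N c * W) (const _ c * S) := by
  intro p₀
  rw [leftSymbol, act_const_mul, map_mul, mapAlgHom_const, Module.End.mul_apply, mulConst_apply, h]
  rfl

theorem commute_weylOp_mulConst (A : Symbol N) (c : PowerSeries ℂ) :
    Commute (weylOp A) (mulConst N c) := by
  ext1 u
  funext p₀
  change weylOp A (mulConst N c u) p₀ = const _ c * weylOp A u p₀
  rw [weylOp_apply, weylOp_apply, mulConst_apply, map_mul (mapAlgHom _), mapAlgHom_const,
    mul_left_comm, act_const_mul, map_mul (mapAlgHom _), mapAlgHom_const]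

/-- Without dependence on `p`, every term containing a `∂_{p_j}` vanishes. -/
theorem weylOp_const (c : PowerSeries ℂ) : weylOp (const (PhaseIdx N) c) = mulConst N c := by
  ext1 u
  funext p₀
  rw [weylOp_apply, mulConst_apply, mapAlgHom_const, act_const_mul, map_mul, mapAlgHom_const,
    act_pullback (middleMap N) (contDiff_middleMap N) (fun i => middleMap N (Pi.single i 1))
      (fun i w t => rfl), map_expS]
  have : MvPolynomial.aeval (fun i => ∑ k, C ((middleMap N (Pi.single i (1 : ℝ)) k : ℝ) : ℂ) * X k)
      (C (-Complex.I) * crossPoly N) = (0 : MvPolynomial (Fin N) ℂ) := by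
    rw [map_mul, crossPoly, map_sum, Finset.sum_eq_zero, mul_zero]
    intro j _
    rw [map_mul, MvPolynomial.aeval_X, MvPolynomial.aeval_X]
    simp [middleMap]
  rw [this, expS_zero, map_one]
  rfl

theorem weylOp_add (A B : Symbol N) : weylOp (A + B) = weylOp A + weylOp B := by
  ext1 u
  funext p₀
  change _ = weylOp A u p₀ + weylOp B u p₀
  rw [weylOp_apply, weylOp_apply, weylOp_apply, map_add, add_mul, map_add, map_add]

theorem weylProd_const (Y : Symbol N) (V : ℕ) : weylProd (fun _ : Fin V => Y) = weylOp Y ^ V := by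
  rw [weylProd, List.ofFn_const, List.prod_replicate]

/-- The binomial expansion of the powers of an operator around a constant. -/
theorem hasSymbol_add_const_pow (Y : Symbol N) (c : PowerSeries ℂ) (k : ℕ) :
    HasSymbol (weylOp (Y + const _ c) ^ k) (∑ V ∈ Finset.range (k + 1),
      (k.choose V : ℂ) • (const _ (c ^ (k - V)) * star fun _ : Fin V => Y)) := by
  rw [weylOp_add, weylOp_const, (commute_weylOp_mulConst Y c).add_pow]
  refine HasSymbol.sum _ fun V _ => ?_
  have : weylOp Y ^ V * mulConst N c ^ (k - V) * (k.choose V : Module.End ℂ (Wave N)) =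
      (k.choose V : ℂ) • (mulConst N (c ^ (k - V)) * weylProd fun _ : Fin V => Y) := by
    rw [weylProd_const, map_pow, ((commute_weylOp_mulConst Y c).pow_pow V (k - V)).eq,
      ← Nat.cast_comm, ← nsmul_eq_mul, Nat.cast_smul_eq_nsmul]
  rw [this]
  exact ((hasSymbol_weylProd _).mulConst_mul _).smul _

/-! ### Expansion of the star product over labeled graphs -/

section Derivatives

variable {ι : Type} [Fintype ι] [DecidableEq ι]

theorem coeff_act_C (P : MvPolynomial ι ℂ) (F : PowerSeries (Smooth ι)) (n : ℕ) :
    PowerSeries.coeff n (act (PowerSeries.C P) F) = opOf P (PowerSeries.coeff n F) := by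
  rw [coeff_act, Finset.sum_eq_single (0, n)]
  · simp
  · rintro ⟨i, j⟩ hij hne
    have : i ≠ 0 := by
      rintro rfl
      replace hij := Finset.HasAntidiagonal.mem_antidiagonal.1 hij
      exact hne (by simp_all)
    simp [PowerSeries.coeff_C, this]
  · simp

theorem act_C_X_mul (i : ι) (F G : PowerSeries (Smooth ι)) :
    act (PowerSeries.C (X i)) (F * G)
      = act (PowerSeries.C (X i)) F * G + F * act (PowerSeries.C (X i)) G := by
  ext1 n
  simp only [coeff_act_C, map_add, PowerSeries.coeff_mul, opOf_X, map_sum, pd_mul,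
    Finset.sum_add_distrib]

/-- Leibniz rule when at most one factor depends on the variable. -/
theorem act_C_X_prod {α : Type*} [DecidableEq α] (i : ι) (F : α → PowerSeries (Smooth ι)) (a : α)
    (h : ∀ b ≠ a, act (PowerSeries.C (X i)) (F b) = 0) (s : Finset α) :
    act (PowerSeries.C (X i)) (∏ b ∈ s, F b) = if a ∈ s then
      ∏ b ∈ s, Function.update F a (act (PowerSeries.C (X i)) (F a)) b else 0 := by
  induction s using Finset.induction_on with
  | empty =>
    ext1 n
    simp only [Finset.prod_empty, coeff_act_C, opOf_X, PowerSeries.coeff_one]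
    split_ifs <;> simp_all [pd_one]
  | insert c s hc ih =>
    rw [Finset.prod_insert hc, act_C_X_mul, ih, Finset.prod_insert hc]
    by_cases hca : c = a
    · subst hca
      simp only [hc, if_false, mul_zero, add_zero, Finset.mem_insert_self, if_true,
        Function.update_self]
      congr 1
      refine Finset.prod_congr rfl fun b hb => ?_
      rw [Function.update_of_ne (by rintro rfl; exact hc hb)]
    · rw [h c hca, zero_mul, zero_add, Function.update_of_ne hca]
      simp [Finset.mem_insert, Ne.symm hca]

end Derivatives

theorem coeff_pdSymbol (μ : PhaseIdx N) (A : Symbol N) (n : ℕ) :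
    PowerSeries.coeff n (pdSymbol μ A) = pd μ (PowerSeries.coeff n A) := by
  simp [pdSymbol]

theorem pdSymbol_sub (μ : PhaseIdx N) (A B : Symbol N) :
    pdSymbol μ (A - B) = pdSymbol μ A - pdSymbol μ B := by
  ext1 n
  simp [coeff_pdSymbol]

theorem pdSymbol_zero (μ : PhaseIdx N) : pdSymbol μ (0 : Symbol N) = 0 := by
  ext1 n
  simp [coeff_pdSymbol]

theorem pdSymbol_const (μ : PhaseIdx N) (c : PowerSeries ℂ) : pdSymbol μ (const _ c) = 0 := by
  ext1 n
  rw [coeff_pdSymbol, const, PowerSeries.coeff_map, Algebra.algebraMap_eq_smul_one, map_smul, pd_one,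
    smul_zero, map_zero]

theorem act_C_X_tens {V : ℕ} (F : Fin V → Symbol N) (w : Fin V) (μ : PhaseIdx N) :
    act (PowerSeries.C (X (w, μ))) (tens F)
      = tens (Function.update F w (pdSymbol μ (F w))) := by
  rw [tens, act_C_X_prod _ _ w, if_pos (Finset.mem_univ w), tens]
  · refine Finset.prod_congr rfl fun v _ => ?_
    by_cases h : v = w
    · subst h
      rw [Function.update_self, Function.update_self]
      ext1 n
      simp only [coeff_act_C, PowerSeries.mapAlgHom_apply, PowerSeries.coeff_map, opOf_X,
        coeff_pdSymbol]
      exact pd_copyMap_self _ _ _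
    · rw [Function.update_of_ne h, Function.update_of_ne h]
  · intro v hv
    ext1 n
    simp only [coeff_act_C, PowerSeries.mapAlgHom_apply, PowerSeries.coeff_map, opOf_X]
    exact pd_copyMap_ne hv.symm _ _

/-- The derivatives at the vertex `v` that are attached to the edges in a list. -/
def listDeriv {V E : ℕ} (Γ : LabeledGraph V E) (μ ν : Fin E → PhaseIdx N) (v : Fin V)
    (l : List (Fin E)) (A : Symbol N) : Symbol N :=
  l.foldr (fun e F => if Γ.tail e = v then pdSymbol (μ e) F
    else if Γ.head e = v then pdSymbol (ν e) F else F) A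

theorem listDeriv_cons {V E : ℕ} (Γ : LabeledGraph V E) (μ ν : Fin E → PhaseIdx N) (v : Fin V)
    (e : Fin E) (l : List (Fin E)) (A : Symbol N) :
    listDeriv Γ μ ν v (e :: l) A = if Γ.tail e = v then pdSymbol (μ e) (listDeriv Γ μ ν v l A)
    else if Γ.head e = v then pdSymbol (ν e) (listDeriv Γ μ ν v l A)
    else listDeriv Γ μ ν v l A := rfl

theorem vertexDeriv_eq_listDeriv {V E : ℕ} (Γ : LabeledGraph V E) (μ ν : Fin E → PhaseIdx N)
    (v : Fin V) (A : Symbol N) :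
    vertexDeriv Γ μ ν v A = listDeriv Γ μ ν v (List.finRange E) A := rfl

namespace LabeledGraph

variable {V E : ℕ} (Γ : LabeledGraph V E)

theorem tail_lt_head (e : Fin E) : Γ.tail e < Γ.head e := Edge.tail_lt_head (Γ e)

theorem mem_edge_iff (e : Fin E) (v : Fin V) : v ∈ (Γ e).1 ↔ Γ.tail e = v ∨ Γ.head e = v := by
  have : (Γ e).1 = {Γ.tail e, Γ.head e} := Edge.eq_pair (Γ e)
  rw [this, Finset.mem_insert, Finset.mem_singleton, eq_comm, @eq_comm _ v]

instance : Fintype (LabeledGraph V E) := inferInstanceAs (Fintype (Fin E → Edge V))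

end LabeledGraph

theorem act_C_list_tens {V E : ℕ} (Γ : LabeledGraph V E) (μ ν : Fin E → PhaseIdx N)
    (l : List (Fin E)) (F : Fin V → Symbol N) :
    act (PowerSeries.C (l.map fun e => X (Γ.tail e, μ e) * X (Γ.head e, ν e)).prod) (tens F)
      = tens fun v => listDeriv Γ μ ν v l (F v) := by
  induction l with
  | nil => simp [listDeriv]
  | cons e l ih =>
    rw [List.map_cons, List.prod_cons, map_mul, act_mul_apply, ih, map_mul, act_mul_apply,
      act_C_X_tens, act_C_X_tens]
    congr 1
    funext v
    rw [listDeriv_cons]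
    -- The end points differ, so the two updates concern different factors.
    have hlt := Γ.tail_lt_head e
    rw [Function.update_of_ne hlt.ne]
    by_cases h1 : v = Γ.tail e
    · subst h1
      simp
    · rw [Function.update_of_ne h1, if_neg (Ne.symm h1)]
      by_cases h2 : v = Γ.head e
      · subst h2
        simp
      · rw [Function.update_of_ne h2, if_neg (Ne.symm h2)]

/-- Expanding the power means choosing one edge from each of the `E` factors, and such a choice is
by definition a labeled graph. -/
theorem edgePoly_pow (V E : ℕ) : edgePoly N V ^ E = ∑ Γ : LabeledGraph V E,
    ∑ μ : Fin E → PhaseIdx N, ∑ ν : Fin E → PhaseIdx N, C (∏ e, poissonTensor N (μ e) (ν e)) *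
      ((List.finRange E).map fun e => X (Γ.tail e, μ e) * X (Γ.head e, ν e)).prod := by
  rw [edgePoly, Fintype.sum_pow]
  refine Finset.sum_congr rfl fun Γ _ => ?_
  rw [Fintype.prod_sum]
  refine Finset.sum_congr rfl fun μ _ => ?_
  rw [Fintype.prod_sum]
  refine Finset.sum_congr rfl fun ν _ => ?_
  rw [Finset.prod_mul_distrib, map_prod, ← Fin.prod_univ_def]
  rfl

theorem act_C_C {ι : Type} [Fintype ι] [DecidableEq ι] (c : ℂ) (F : PowerSeries (Smooth ι)) :
    act (PowerSeries.C (C c)) F = c • F := by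
  ext1 n
  rw [coeff_act_C, opOf_C]
  rfl

theorem mapAlgHom_copiesMap_tens {V : ℕ} (F : Fin V → Symbol N) :
    mapAlgHom (pullback (copiesMap V) (contDiff_copiesMap V)) (tens F) = ∏ v, F v := by
  rw [tens, map_prod]
  rfl

theorem copiesMap_edgePoly_pow {V : ℕ} (E : ℕ) (F : Fin V → Symbol N) :
    mapAlgHom (pullback (copiesMap V) (contDiff_copiesMap V))
      (act (PowerSeries.C (edgePoly N V ^ E)) (tens F)) =
      ∑ Γ : LabeledGraph V E, graphPoly Γ F := by
  simp only [edgePoly_pow, map_sum, LinearMap.sum_apply, graphPoly]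
  refine Finset.sum_congr rfl fun Γ _ => Finset.sum_congr rfl fun μ _ =>
    Finset.sum_congr rfl fun ν _ => ?_
  rw [map_mul PowerSeries.C, act_mul_apply, act_C_C, act_C_list_tens, map_smul,
    mapAlgHom_copiesMap_tens]
  rfl

theorem planckFactor_eq (E : ℕ) :
    planckFactor N E = (Complex.I / 2) ^ E • (PowerSeries.X : Symbol N) ^ E := by
  rw [planckFactor, smul_pow]

theorem coeff_planckFactor_mul (E n : ℕ) (G : Symbol N) :
    PowerSeries.coeff n (planckFactor N E * G) =
      if E ≤ n then (Complex.I / 2) ^ E • PowerSeries.coeff (n - E) G else 0 := by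
  rw [planckFactor_eq, smul_mul_assoc, PowerSeries.coeff_smul, PowerSeries.coeff_X_pow_mul', smul_ite,
    smul_zero]

theorem coeff_star {V : ℕ} (F : Fin V → Symbol N) (n : ℕ) :
    PowerSeries.coeff n (star F) = ∑ E ∈ Finset.range (n + 1), (1 / (E.factorial : ℂ)) •
      PowerSeries.coeff n (planckFactor N E * ∑ Γ : LabeledGraph V E, graphPoly Γ F) := by
  rw [star, PowerSeries.mapAlgHom_apply, PowerSeries.coeff_map, coeff_act, map_sum]
  have := Finset.Nat.sum_antidiagonal_eq_sum_range_succ (M := Smooth (PhaseIdx N)) (fun E r =>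
    (pullback (copiesMap V) (contDiff_copiesMap V)) (opOf (PowerSeries.coeff E
      (expS (C (Complex.I / 2) * edgePoly N V))) (PowerSeries.coeff r (tens F)))) n
  refine this.trans (Finset.sum_congr rfl fun E hE => ?_)
  rw [coeff_planckFactor_mul, if_pos (by simpa [Nat.lt_succ_iff] using hE), coeff_expS, mul_pow,
    ← MvPolynomial.C_pow, opOf_mul_apply, opOf_C, map_smul, opOf_mul_apply, opOf_C, map_smul,
    ← copiesMap_edgePoly_pow, PowerSeries.mapAlgHom_apply, PowerSeries.coeff_map, coeff_act_C]
  rfl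

/-! ### Evaluation at a point of phase space -/

/-- Evaluation at a point. -/
def evalAt (z : PhaseIdx N → ℝ) : Smooth (PhaseIdx N) →ₐ[ℂ] ℂ where
  toFun F := F.1 z
  map_one' := rfl
  map_mul' _ _ := rfl
  map_zero' := rfl
  map_add' _ _ := rfl
  commutes' _ := rfl

/-- Evaluation of a formal symbol at a point. -/
def evalSymbol (z : PhaseIdx N → ℝ) : Symbol N →ₐ[ℂ] PowerSeries ℂ := mapAlgHom (evalAt z)

theorem coeff_evalSymbol (z : PhaseIdx N → ℝ) (A : Symbol N) (n : ℕ) :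
    PowerSeries.coeff n (evalSymbol z A) = (PowerSeries.coeff n A).1 z := by
  rw [evalSymbol, PowerSeries.mapAlgHom_apply, PowerSeries.coeff_map]
  rfl

theorem evalSymbol_const (z : PhaseIdx N → ℝ) (c : PowerSeries ℂ) :
    evalSymbol z (const _ c) = c := by
  ext1 n
  rw [coeff_evalSymbol, const, PowerSeries.coeff_map]
  rfl

theorem evalSymbol_planckFactor (z : PhaseIdx N → ℝ) (E : ℕ) :
    evalSymbol z (planckFactor N E) = (Complex.I / 2) ^ E • PowerSeries.X ^ E := by
  rw [planckFactor_eq, map_smul, map_pow, evalSymbol, PowerSeries.mapAlgHom_apply,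
    PowerSeries.map_X]

theorem coeff_evalSymbol_star {V : ℕ} (z : PhaseIdx N → ℝ) (F : Fin V → Symbol N) (n : ℕ) :
    PowerSeries.coeff n (evalSymbol z (star F)) = ∑ E ∈ Finset.range (n + 1),
      1 / (E.factorial : ℂ) * PowerSeries.coeff n (evalSymbol z (planckFactor N E) *
        ∑ Γ : LabeledGraph V E, evalSymbol z (graphPoly Γ F)) := by
  have h : ∀ A : Symbol N, PowerSeries.coeff n (evalSymbol z A) = evalAt z (PowerSeries.coeff n A) :=
    fun A => coeff_evalSymbol z A n
  rw [h, coeff_star, map_sum]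
  refine Finset.sum_congr rfl fun E _ => ?_
  rw [map_smul, ← h, map_mul, map_sum, smul_eq_mul]

/-! ### Isolated vertices and reduced graphs -/

section Isolated

variable {V E : ℕ} (Γ : LabeledGraph V E) (μ ν : Fin E → PhaseIdx N) (v : Fin V)

theorem listDeriv_sub (l : List (Fin E)) (A B : Symbol N) :
    listDeriv Γ μ ν v l (A - B) = listDeriv Γ μ ν v l A - listDeriv Γ μ ν v l B := by
  induction l with
  | nil => rfl
  | cons e l ih =>
    simp only [listDeriv_cons, ih, pdSymbol_sub]
    split_ifs <;> rfl

theorem listDeriv_of_isolated (l : List (Fin E)) (h : ∀ e ∈ l, v ∉ (Γ e).1) (A : Symbol N) :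
    listDeriv Γ μ ν v l A = A := by
  induction l with
  | nil => rfl
  | cons e l ih =>
    have he := h e (by simp)
    rw [LabeledGraph.mem_edge_iff, not_or] at he
    rw [listDeriv_cons, if_neg he.1, if_neg he.2, ih fun e' he' => h e' (by simp [he'])]

theorem listDeriv_const (l : List (Fin E)) (h : ∃ e ∈ l, v ∈ (Γ e).1) (c : PowerSeries ℂ) :
    listDeriv Γ μ ν v l (const _ c) = 0 := by
  induction l with
  | nil => simp at h
  | cons e l ih =>
    rw [listDeriv_cons]
    by_cases hl : ∃ e ∈ l, v ∈ (Γ e).1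
    · simp [ih hl, pdSymbol_zero]
    · have he : v ∈ (Γ e).1 := by
        obtain ⟨e', he', hv⟩ := h
        rcases List.mem_cons.1 he' with rfl | he'
        · exact hv
        · exact absurd ⟨e', he', hv⟩ hl
      rw [listDeriv_of_isolated Γ μ ν v l (by simpa using hl), pdSymbol_const, pdSymbol_const]
      rcases (Γ.mem_edge_iff e v).1 he with h | h <;> simp [h]

end Isolated

theorem graphPoly_sub_const {V E : ℕ} {Γ : LabeledGraph V E} (hΓ : Γ.Reduced) (A : Symbol N)
    (c : PowerSeries ℂ) : (graphPoly Γ fun _ => A - const _ c) = graphPoly Γ fun _ => A := by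
  simp only [graphPoly, vertexDeriv_eq_listDeriv, listDeriv_sub]
  refine Finset.sum_congr rfl fun μ _ => Finset.sum_congr rfl fun ν _ => ?_
  congr 1
  refine Finset.prod_congr rfl fun v _ => ?_
  obtain ⟨e, he⟩ := hΓ v
  rw [listDeriv_const Γ μ ν v _ ⟨e, List.mem_finRange e, he⟩, sub_zero]

/-- The edges cover at most `2 * E` vertices. The subtraction is truncated, so the bound is vacuous
when there are many edges. -/
theorem card_le_isolated {V E : ℕ} (Γ : LabeledGraph V E) (s : Finset (Fin V)) [DecidablePred fun v =>
    ∀ e, v ∉ (Γ e).1] : s.card - 2 * E ≤ (s.filter fun v => ∀ e, v ∉ (Γ e).1).card := by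
  have h1 : (Finset.univ.biUnion fun e => (Γ e).1).card ≤ E * 2 := by
    refine (Finset.card_biUnion_le_card_mul _ _ 2 fun e _ => (Γ e).2.le).trans ?_
    simp
  have h2 : s ⊆ (s.filter fun v => ∀ e, v ∉ (Γ e).1) ∪ Finset.univ.biUnion fun e => (Γ e).1 := by
    intro v hv
    by_cases h : ∀ e, v ∉ (Γ e).1
    · simp [hv, h]
    · push Not at h
      simp [h]
  have := (Finset.card_le_card h2).trans (Finset.card_union_le _ _)
  omega

/-- Factors at isolated vertices are not differentiated and so keep their divisibility by `ħ` at
`z`. -/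
theorem X_pow_dvd_graphPoly {V E : ℕ} (Γ : LabeledGraph V E) (z : PhaseIdx N → ℝ)
    (F : Fin V → Symbol N) (s : Finset (Fin V))
    (hs : ∀ v ∈ s, (PowerSeries.X : PowerSeries ℂ) ∣ evalSymbol z (F v)) :
    (PowerSeries.X : PowerSeries ℂ) ^ (s.card - 2 * E) ∣ evalSymbol z (graphPoly Γ F) := by
  classical
  simp only [graphPoly, map_sum, map_smul, map_prod]
  refine Finset.dvd_sum fun μ _ => Finset.dvd_sum fun ν _ => dvd_smul_of_dvd _ ?_
  refine (pow_dvd_pow _ (card_le_isolated Γ s)).trans ?_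
  rw [← Finset.prod_const]
  refine (Finset.prod_dvd_prod_of_dvd _ (fun v => evalSymbol z (vertexDeriv Γ μ ν v (F v)))
    fun v hv => ?_).trans (Finset.prod_dvd_prod_of_subset _ _ _ (Finset.subset_univ _))
  rw [Finset.mem_filter] at hv
  rw [vertexDeriv_eq_listDeriv, listDeriv_of_isolated Γ μ ν v _ fun e _ => hv.2 e]
  exact hs v hv.1

theorem evalSymbol_graphPoly_of_not_reduced {V E : ℕ} {Γ : LabeledGraph V E} (hΓ : ¬ Γ.Reduced)
    (z : PhaseIdx N → ℝ) (F : Fin V → Symbol N) (hF : ∀ v, evalSymbol z (F v) = 0) :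
    evalSymbol z (graphPoly Γ F) = 0 := by
  simp only [LabeledGraph.Reduced, not_forall, not_exists] at hΓ
  obtain ⟨v, hv⟩ := hΓ
  simp only [graphPoly, map_sum, map_smul, map_prod]
  refine Finset.sum_eq_zero fun μ _ => Finset.sum_eq_zero fun ν _ => ?_
  rw [Finset.prod_eq_zero (Finset.mem_univ v), smul_zero]
  rw [vertexDeriv_eq_listDeriv, listDeriv_of_isolated Γ μ ν v _ fun e _ => hv e, hF]

theorem LabeledGraph.Reduced.le_two_mul {V E : ℕ} {Γ : LabeledGraph V E} (hΓ : Γ.Reduced) :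
    V ≤ 2 * E := by
  classical
  have h := card_le_isolated Γ Finset.univ
  rw [Finset.filter_false_of_mem] at h
  · rw [Finset.card_univ, Fintype.card_fin, Finset.card_empty] at h
    omega
  · intro v _ hv
    obtain ⟨e, he⟩ := hΓ v
    exact hv e he

/-- The remainder of the Taylor expansion does not contribute to low orders. -/
theorem coeff_evalSymbol_star_eq_zero {V : ℕ} (z : PhaseIdx N → ℝ) (F : Fin V → Symbol N)
    (s : Finset (Fin V)) (hs : ∀ v ∈ s, (PowerSeries.X : PowerSeries ℂ) ∣ evalSymbol z (F v))
    (m : ℕ) (hm : 2 * m < s.card) : PowerSeries.coeff m (evalSymbol z (star F)) = 0 := by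
  rw [coeff_evalSymbol_star]
  refine Finset.sum_eq_zero fun E _ => ?_
  rw [evalSymbol_planckFactor, smul_mul_assoc, PowerSeries.coeff_smul]
  -- Whatever `E` is, this exponent is at least `s.card / 2`, hence larger than `m`.
  have h : (PowerSeries.X : PowerSeries ℂ) ^ (E + (s.card - 2 * E)) ∣ PowerSeries.X ^ E *
      ∑ Γ : LabeledGraph V E, evalSymbol z (graphPoly Γ F) := by
    rw [pow_add]
    exact mul_dvd_mul_left _ (Finset.dvd_sum fun Γ _ => X_pow_dvd_graphPoly Γ z F s hs)
  rw [PowerSeries.X_pow_dvd_iff.1 h m (by omega), smul_zero, mul_zero]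

open Classical in
/-- The value at `z` of `∑_Γ (iħ/2)^E λ_Γ(A) / E!` for reduced `Γ` with given `V` and `E`. -/
def reducedSum (V E : ℕ) (z : PhaseIdx N → ℝ) (A : Symbol N) : PowerSeries ℂ :=
  (1 / (E.factorial : ℂ)) • (evalSymbol z (planckFactor N E) *
    ∑ Γ : LabeledGraph V E with Γ.Reduced, evalSymbol z (graphPoly Γ fun _ => A))

theorem X_pow_dvd_reducedSum (V E : ℕ) (z : PhaseIdx N → ℝ) (A : Symbol N) :
    (PowerSeries.X : PowerSeries ℂ) ^ E ∣ reducedSum V E z A := by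
  rw [reducedSum, evalSymbol_planckFactor, smul_mul_assoc]
  exact dvd_smul_of_dvd _ (dvd_smul_of_dvd _ (Dvd.intro _ rfl))

theorem reducedSum_eq_zero {V E : ℕ} (h : 2 * E < V) (z : PhaseIdx N → ℝ) (A : Symbol N) :
    reducedSum V E z A = 0 := by
  classical
  rw [reducedSum, Finset.sum_eq_zero, mul_zero, smul_zero]
  intro Γ hΓ
  have := (Finset.mem_filter.1 hΓ).2.le_two_mul
  omega

/-- Terms with more than `n` edges do not matter at order `n`. The free bound `m` lets all orders up
to `m` share one finite sum, as `coeff_mul_congr` will need. -/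
theorem coeff_evalSymbol_star_sub_const {V : ℕ} (z : PhaseIdx N → ℝ) (A : Symbol N) (n m : ℕ)
    (h : n ≤ m) : PowerSeries.coeff n
      (evalSymbol z (star fun _ : Fin V => A - const _ (evalSymbol z A))) =
      PowerSeries.coeff n (∑ E ∈ Finset.range (m + 1), reducedSum V E z A) := by
  classical
  have hsum : ∀ E, (∑ Γ : LabeledGraph V E,
      evalSymbol z (graphPoly Γ fun _ => A - const _ (evalSymbol z A))) =
      ∑ Γ : LabeledGraph V E with Γ.Reduced, evalSymbol z (graphPoly Γ fun _ => A) := by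
    intro E
    rw [Finset.sum_filter]
    refine Finset.sum_congr rfl fun Γ _ => ?_
    split_ifs with hΓ
    · rw [graphPoly_sub_const hΓ]
    · exact evalSymbol_graphPoly_of_not_reduced hΓ z _ fun v => by
        rw [map_sub, evalSymbol_const, sub_self]
  rw [coeff_evalSymbol_star, map_sum]
  refine (Finset.sum_congr rfl fun E _ => ?_).trans
    (Finset.sum_subset (Finset.range_mono (Nat.succ_le_succ h)) ?_)
  · rw [reducedSum, PowerSeries.coeff_smul, smul_eq_mul, hsum]
  · intro E _ hE
    exact PowerSeries.X_pow_dvd_iff.1 (X_pow_dvd_reducedSum V E z A) n (by simpa using hE)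

/-! ### Taylor expansion in an algebra of smooth functions -/

/-- Each derivative in `y` brings out one more `t`; allowing any power of `t` keeps the family
closed under differentiation, which drives the smoothness induction. -/
theorem hasDerivAt_integral_segment {h : ℝ → ℝ} (hh : ContDiff ℝ ∞ h) (a : ℝ) (k : ℕ) (y₀ : ℝ) :
    HasDerivAt (fun y => ∫ t in (0 : ℝ)..1, t ^ k * h (a + t * (y - a)))
      (∫ t in (0 : ℝ)..1, t ^ (k + 1) * deriv h (a + t * (y₀ - a))) y₀ := by
  have hc : Continuous h := hh.continuous
  have hd : Continuous (deriv h) := hh.continuous_deriv (by simp)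
  obtain ⟨M, hM⟩ := ((isCompact_Icc (a := (0 : ℝ)) (b := 1)).prod
    (isCompact_closedBall y₀ 1)).exists_bound_of_continuousOn
    (f := fun q : ℝ × ℝ => q.1 ^ (k + 1) * deriv h (a + q.1 * (q.2 - a))) (by fun_prop)
  refine (intervalIntegral.hasDerivAt_integral_of_dominated_loc_of_deriv_le
    (F := fun y t => t ^ k * h (a + t * (y - a)))
    (F' := fun y t => t ^ (k + 1) * deriv h (a + t * (y - a)))
    (bound := fun _ => M) (Metric.closedBall_mem_nhds y₀ one_pos) ?_ ?_ ?_ ?_ ?_ ?_).2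
  · exact Filter.Eventually.of_forall fun y => Continuous.aestronglyMeasurable (by fun_prop)
  · exact Continuous.intervalIntegrable (by fun_prop) _ _
  · exact Continuous.aestronglyMeasurable (by fun_prop)
  · refine Filter.Eventually.of_forall fun t ht y hy => hM (t, y) ⟨?_, hy⟩
    rw [Set.uIoc_of_le zero_le_one] at ht
    exact Set.Ioc_subset_Icc_self ht
  · exact intervalIntegrable_const
  · refine Filter.Eventually.of_forall fun t _ y _ => ?_
    have h1 : HasDerivAt (fun y => a + t * (y - a)) t y := by
      simpa using (((hasDerivAt_id y).sub_const a).const_mul t).const_add a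
    have h2 : HasDerivAt h (deriv h (a + t * (y - a))) (a + t * (y - a)) :=
      (hh.differentiable (by simp) _).hasDerivAt
    exact ((h2.comp y h1).const_mul (t ^ k)).congr_deriv (by ring)

theorem contDiff_integral_segment {h : ℝ → ℝ} (hh : ContDiff ℝ ∞ h) (a : ℝ) (k : ℕ) :
    ContDiff ℝ ∞ (fun y => ∫ t in (0 : ℝ)..1, t ^ k * h (a + t * (y - a))) := by
  rw [contDiff_infty]
  intro n
  induction n generalizing h k with
  | zero =>
    exact contDiff_zero.2 (continuous_iff_continuousAt.2 fun y =>
      (hasDerivAt_integral_segment hh a k y).continuousAt)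
  | succ n ih =>
    rw [Nat.cast_succ, contDiff_succ_iff_deriv]
    refine ⟨fun y => (hasDerivAt_integral_segment hh a k y).differentiableAt, by simp, ?_⟩
    have : deriv (fun y => ∫ t in (0 : ℝ)..1, t ^ k * h (a + t * (y - a))) =
        fun y => ∫ t in (0 : ℝ)..1, t ^ (k + 1) * deriv h (a + t * (y - a)) :=
      funext fun y => (hasDerivAt_integral_segment hh a k y).deriv
    rw [this]
    exact ih (by simpa using hh.iterate_deriv 1) (k + 1)

/-- Hadamard's lemma in one variable. -/
theorem exists_smooth_quotient {f : ℝ → ℝ} (hf : ContDiff ℝ ∞ f) (a : ℝ) :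
    ∃ g : ℝ → ℝ, ContDiff ℝ ∞ g ∧ ∀ y, f y = f a + (y - a) * g y := by
  have hd : ContDiff ℝ ∞ (deriv f) := by simpa using hf.iterate_deriv 1
  refine ⟨fun y => ∫ t in (0 : ℝ)..1, t ^ 0 * deriv f (a + t * (y - a)),
    contDiff_integral_segment hd a 0, fun y => ?_⟩
  have hc : Continuous (deriv f) := hd.continuous
  have key : ∫ t in (0 : ℝ)..1, (y - a) * deriv f (a + t * (y - a))
      = f (a + 1 * (y - a)) - f (a + 0 * (y - a)) := by
    refine intervalIntegral.integral_eq_sub_of_hasDerivAt (f := fun t => f (a + t * (y - a)))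
      (fun t _ => ?_)
      (Continuous.intervalIntegrable (by fun_prop) _ _)
    have h1 : HasDerivAt (fun t => a + t * (y - a)) (y - a) t := by
      simpa using ((hasDerivAt_id t).mul_const (y - a)).const_add a
    have h2 : HasDerivAt f (deriv f (a + t * (y - a))) (a + t * (y - a)) :=
      (hf.differentiable (by simp) _).hasDerivAt
    exact (h2.comp t h1).congr_deriv (by ring)
  rw [intervalIntegral.integral_const_mul] at key
  simp only [pow_zero, one_mul]
  rw [key]
  simp

theorem iteratedDeriv_succ_sub_mul {g : ℝ → ℝ} (hg : ContDiff ℝ ∞ g) (a : ℝ) (k : ℕ) :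
    iteratedDeriv (k + 1) (fun y => (y - a) * g y) =
      fun y => (k + 1) * iteratedDeriv k g y + (y - a) * iteratedDeriv (k + 1) g y := by
  have hd : ∀ j y, HasDerivAt (iteratedDeriv j g) (iteratedDeriv (j + 1) g y) y := by
    intro j y
    rw [iteratedDeriv_succ]
    exact ((contDiff_iteratedDeriv hg j).differentiable (by simp) y).hasDerivAt
  induction k with
  | zero =>
    funext y
    rw [zero_add, iteratedDeriv_one]
    have h := ((hasDerivAt_id y).sub_const a).mul (hd 0 y)
    simp only [iteratedDeriv_zero] at h
    refine h.deriv.trans ?_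
    simp
  | succ k ih =>
    funext y
    rw [iteratedDeriv_succ, ih]
    have h := ((hd k y).const_mul ((k : ℝ) + 1)).add
      (((hasDerivAt_id y).sub_const a).mul (hd (k + 1) y))
    refine h.deriv.trans ?_
    simp only [id]
    push_cast
    ring

/-- Repeated use of Hadamard's lemma; the division property of `𝒜` keeps each quotient in `𝒜`, so
that the functional calculus applies to the remainder. -/
theorem IsFunctionAlgebra.exists_taylor {𝒜 : Subalgebra ℝ (ℝ → ℝ)} (h𝒜 : IsFunctionAlgebra 𝒜)
    (a : ℝ) (n : ℕ) (f : 𝒜) : ∃ g : 𝒜, f = ∑ k ∈ Finset.range n,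
      (iteratedDeriv k f.1 a / (k.factorial : ℝ)) •
        ((⟨fun y => y, h𝒜.id_mem⟩ : 𝒜) - algebraMap ℝ 𝒜 a) ^ k +
      g * ((⟨fun y => y, h𝒜.id_mem⟩ : 𝒜) - algebraMap ℝ 𝒜 a) ^ n := by
  induction n generalizing f with
  | zero => exact ⟨f, by simp⟩
  | succ n ih =>
    obtain ⟨g, hg, hfg⟩ := exists_smooth_quotient (h𝒜.smooth f.1 f.2) a
    have hmul : (fun y => (y - a) * g y) = f.1 - algebraMap ℝ (ℝ → ℝ) (f.1 a) := by
      funext y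
      change _ = f.1 y - f.1 a
      rw [hfg y]
      ring
    have hg𝒜 : g ∈ 𝒜 := h𝒜.div_mem a g hg (by
      rw [hmul]
      exact sub_mem f.2 (algebraMap_mem _ _))
    obtain ⟨r, hr⟩ := ih ⟨g, hg𝒜⟩
    have hf : f = algebraMap ℝ 𝒜 (f.1 a) +
        ((⟨fun y => y, h𝒜.id_mem⟩ : 𝒜) - algebraMap ℝ 𝒜 a) * ⟨g, hg𝒜⟩ := by
      apply Subtype.ext
      funext y
      exact hfg y
    have hder : ∀ k, iteratedDeriv (k + 1) f.1 a = (k + 1) * iteratedDeriv k g a := by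
      intro k
      have h1 : f.1 = fun y => f.1 a + (y - a) * g y := funext hfg
      have h2 := congrFun (iteratedDeriv_succ_sub_mul hg a k) a
      rw [sub_self, zero_mul, add_zero] at h2
      rw [← h2]
      conv_lhs => rw [h1]
      rw [iteratedDeriv_succ', iteratedDeriv_succ']
      congr 1
      funext y
      rw [deriv_const_add]
    refine ⟨r, ?_⟩
    set Y := (⟨fun y => y, h𝒜.id_mem⟩ : 𝒜) - algebraMap ℝ 𝒜 a with hY
    rw [Finset.sum_range_succ', pow_zero, iteratedDeriv_zero, Nat.factorial_zero, Nat.cast_one,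
      div_one, ← Algebra.algebraMap_eq_smul_one]
    conv_lhs => rw [hf, hr]
    rw [mul_add, Finset.mul_sum]
    have : ∀ k ∈ Finset.range n, Y * (iteratedDeriv k g a / (k.factorial : ℝ)) • Y ^ k =
        (iteratedDeriv (k + 1) f.1 a / ((k + 1).factorial : ℝ)) • Y ^ (k + 1) := by
      intro k _
      rw [hder, Nat.factorial_succ, Nat.cast_mul, Nat.cast_succ,
        mul_div_mul_left _ _ (by positivity), pow_succ', mul_smul_comm]
    rw [Finset.sum_congr rfl this]
    ring

/-! ### The symbol of a function of an operator, at a point -/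

theorem coeff_mul_congr {R : Type*} [CommRing R] {m : ℕ} {P Q : PowerSeries R} (S : PowerSeries R)
    (h : ∀ i ≤ m, PowerSeries.coeff i P = PowerSeries.coeff i Q) :
    PowerSeries.coeff m (P * S) = PowerSeries.coeff m (Q * S) := by
  rw [PowerSeries.coeff_mul, PowerSeries.coeff_mul]
  refine Finset.sum_congr rfl fun q hq => ?_
  have := Finset.HasAntidiagonal.mem_antidiagonal.1 hq
  rw [h q.1 (by omega)]

theorem coeff_evalSymbol_compSymbol (z : PhaseIdx N → ℝ) {f : ℝ → ℝ} (hf : ContDiff ℝ ∞ f)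
    (A : Symbol N) (i : ℕ) :
    PowerSeries.coeff i (evalSymbol z (compSymbol f hf A)) = ∑ j ∈ Finset.range (i + 1),
      1 / (j.factorial : ℂ) * ((iteratedDeriv j f ((PowerSeries.coeff 0 A).1 z).re : ℝ) *
        PowerSeries.coeff i ((evalSymbol z A -
          PowerSeries.C ((PowerSeries.coeff 0 A).1 z)) ^ j)) := by
  rw [coeff_evalSymbol, compSymbol, PowerSeries.coeff_mk]
  change evalAt z _ = _
  rw [map_sum]
  refine Finset.sum_congr rfl fun j _ => ?_
  rw [map_smul, map_mul, smul_eq_mul]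
  have h1 : evalAt z (PowerSeries.coeff i ((A - PowerSeries.C (PowerSeries.coeff 0 A)) ^ j)) =
      PowerSeries.coeff i (evalSymbol z ((A - PowerSeries.C (PowerSeries.coeff 0 A)) ^ j)) :=
    (coeff_evalSymbol z _ i).symm
  have h2 : evalSymbol z (PowerSeries.C (PowerSeries.coeff 0 A)) =
      PowerSeries.C ((PowerSeries.coeff 0 A).1 z) := by
    rw [evalSymbol, PowerSeries.mapAlgHom_apply, PowerSeries.map_C]
    rfl
  rw [h1, map_pow, map_sub, h2]
  rfl

-- The heart of the proof: Taylor expansion at the real number `a₀ = A₀(z)`, followed by a binomial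
-- expansion around the full value `a = A(z)`. The first must be at a real point because `f` is
-- defined on `ℝ`; the second makes the symbol `Y = A - a` vanish at `z`.
set_option synthInstance.maxHeartbeats 200000 in
theorem coeff_evalSymbol_functional_calculus {A : Symbol N}
    (hA : ∀ z, ((PowerSeries.coeff 0 A).1 z).im = 0)
    {𝒜 : Subalgebra ℝ (ℝ → ℝ)} (h𝒜 : IsFunctionAlgebra 𝒜)
    (Φ : 𝒜 →ₐ[ℝ] Module.End ℂ (Wave N))
    (hΦ_id : Φ ⟨fun y => y, h𝒜.id_mem⟩ = weylOp A)
    (hΦ_symbol : ∀ g : 𝒜, ∃ C : Symbol N, Φ g = weylOp C)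
    (f : 𝒜) (B : Symbol N) (hB : Φ f = weylOp B) (z : PhaseIdx N → ℝ) (m : ℕ) :
    PowerSeries.coeff m (evalSymbol z B) =
      ∑ V ∈ Finset.range (2 * m + 1), ∑ E ∈ Finset.range (m + 1),
        PowerSeries.coeff m ((1 / (V.factorial : ℂ)) • evalSymbol z (compSymbol (iteratedDeriv V f.1)
          (contDiff_iteratedDeriv (h𝒜.smooth f.1 f.2) V) A) * reducedSum V E z A) := by
  set a₀ : ℝ := ((PowerSeries.coeff 0 A).1 z).re with ha₀
  have ha₀' : (PowerSeries.coeff 0 A).1 z = (a₀ : ℂ) := by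
    exact Complex.ext rfl (hA z)
  set a := evalSymbol z A with ha
  set α : PowerSeries ℂ := a - PowerSeries.C (a₀ : ℂ) with hα
  have hαX : (PowerSeries.X : PowerSeries ℂ) ∣ α := by
    rw [PowerSeries.X_dvd_iff, hα, map_sub, PowerSeries.constantCoeff_C,
      ← PowerSeries.coeff_zero_eq_constantCoeff_apply, ha, coeff_evalSymbol, ha₀', sub_self]
  set Y : Symbol N := A - const _ a with hY
  set Z : Symbol N := Y + const _ α with hZ
  -- The least `n` with `2 * m < n`, as the vanishing of the remainder at order `ħ^m` requires.
  set n := 2 * m + 1 with hn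
  -- the operator
  have hΦZ : Φ ((⟨fun y => y, h𝒜.id_mem⟩ : 𝒜) - algebraMap ℝ 𝒜 a₀) = weylOp Z := by
    have h1 : A = Z + const _ (PowerSeries.C (a₀ : ℂ)) := by
      rw [hZ, hY, add_assoc, ← map_add, hα, sub_add_cancel, sub_add_cancel]
    rw [map_sub, hΦ_id, AlgHom.commutes]
    conv_lhs => rw [h1]
    rw [weylOp_add, weylOp_const]
    have h2 : mulConst N (PowerSeries.C (a₀ : ℂ)) = algebraMap ℝ _ a₀ := by
      ext1 u
      funext p₀
      rw [mulConst_apply, const, PowerSeries.map_C]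
      change _ = a₀ • u p₀
      rw [← PowerSeries.smul_eq_C_mul]
      ext1 k
      rw [PowerSeries.coeff_smul]
      apply Subtype.ext
      funext x
      change (a₀ : ℂ) * _ = a₀ • _
      rw [Complex.real_smul]
      rfl
    rw [h2]
    exact add_sub_cancel_right (weylOp Z) _
  obtain ⟨g, hg⟩ := h𝒜.exists_taylor a₀ n f
  -- Of the remainder only the existence of a symbol is used; the smallness comes from the `n`
  -- factors `Z` beside it.
  obtain ⟨G, hG⟩ := hΦ_symbol g
  have hΦf : Φ f = ∑ k ∈ Finset.range n,
      ((iteratedDeriv k f.1 a₀ / (k.factorial : ℝ) : ℝ) : ℂ) • weylOp Z ^ k +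
        weylProd (Fin.cons G fun _ : Fin n => Z : Fin (n + 1) → Symbol N) := by
    conv_lhs => rw [hg]
    simp only [map_add, map_sum, map_smul, map_mul, map_pow, hΦZ, hG]
    congr 1
    rw [weylProd, List.ofFn_succ, List.prod_cons]
    simp only [Fin.cons_zero, Fin.cons_succ, List.ofFn_const, List.prod_replicate]
  have hsymb : B = ∑ k ∈ Finset.range n, ((iteratedDeriv k f.1 a₀ / (k.factorial : ℝ) : ℝ) : ℂ) •
      (∑ V ∈ Finset.range (k + 1),
        (k.choose V : ℂ) • (const _ (α ^ (k - V)) * star fun _ : Fin V => Y)) +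
        star (Fin.cons G fun _ : Fin n => Z : Fin (n + 1) → Symbol N) := by
    refine (hasSymbol_weylOp B).unique ?_
    rw [← hB, hΦf]
    exact (HasSymbol.sum _ fun k _ => (hasSymbol_add_const_pow Y α k).smul _).add
      (hasSymbol_weylProd _)
  have hrem : PowerSeries.coeff m (evalSymbol z
      (star (Fin.cons G fun _ : Fin n => Z : Fin (n + 1) → Symbol N))) = 0 := by
    refine coeff_evalSymbol_star_eq_zero z _ (Finset.univ.image Fin.succ) ?_ m ?_
    · intro v hv
      obtain ⟨w, -, rfl⟩ := Finset.mem_image.1 hv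
      rw [Fin.cons_succ, hZ, hY, map_add, map_sub, evalSymbol_const, evalSymbol_const, sub_self,
        zero_add]
      exact hαX
    · rw [Finset.card_image_of_injective _ (Fin.succ_injective n)]
      simp [hn]
  -- the coefficients
  set c : ℕ → ℕ → ℂ := fun V j => PowerSeries.coeff m
    (α ^ j * ∑ E ∈ Finset.range (m + 1), reducedSum V E z A) with hc
  -- A nonzero term needs `V ≤ 2E` and `j + E ≤ m`, hence `V + j ≤ 2m < n`.
  have hc0 : ∀ V j, n ≤ V + j → c V j = 0 := by
    intro V j hVj
    simp only [hc, Finset.mul_sum, map_sum]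
    refine Finset.sum_eq_zero fun E _ => ?_
    by_cases hE : 2 * E < V
    · rw [reducedSum_eq_zero hE, mul_zero, map_zero]
    · have hd : (PowerSeries.X : PowerSeries ℂ) ^ (j + E) ∣ α ^ j * reducedSum V E z A := by
        rw [pow_add]
        exact mul_dvd_mul (pow_dvd_pow_of_dvd hαX j) (X_pow_dvd_reducedSum V E z A)
      exact PowerSeries.X_pow_dvd_iff.1 hd m (by omega)
  have hterm : ∀ V j, PowerSeries.coeff m (evalSymbol z
      (const _ (α ^ j) * star fun _ : Fin V => Y)) = c V j := by
    intro V j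
    rw [map_mul, evalSymbol_const, hc, mul_comm]
    simp only [mul_comm (α ^ j)]
    exact coeff_mul_congr _ fun i hi => coeff_evalSymbol_star_sub_const z A i m hi
  have hcomp : ∀ V, ∑ E ∈ Finset.range (m + 1), PowerSeries.coeff m
      ((1 / (V.factorial : ℂ)) • evalSymbol z (compSymbol (iteratedDeriv V f.1)
        (contDiff_iteratedDeriv (h𝒜.smooth f.1 f.2) V) A) * reducedSum V E z A) =
      ∑ j ∈ Finset.range n, (1 / (V.factorial : ℂ)) * (1 / (j.factorial : ℂ)) *
        (iteratedDeriv (V + j) f.1 a₀ : ℝ) * c V j := by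
    intro V
    -- Up to order `m`, the series `f^{(V)}(A)(z)` is a Taylor polynomial in `α` of length `n`:
    -- since `ħ ∣ α`, lengthening the sum that defines each coefficient adds only zeros.
    rw [← map_sum, ← Finset.mul_sum, coeff_mul_congr (Q := ∑ j ∈ Finset.range n,
      ((1 / (V.factorial : ℂ)) * (1 / (j.factorial : ℂ)) *
        (iteratedDeriv (V + j) f.1 a₀ : ℝ)) • α ^ j)]
    · rw [Finset.sum_mul, map_sum]
      refine Finset.sum_congr rfl fun j _ => ?_
      rw [smul_mul_assoc, PowerSeries.coeff_smul, smul_eq_mul]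
    · intro i hi
      rw [PowerSeries.coeff_smul, coeff_evalSymbol_compSymbol, map_sum, ← ha, ha₀', ← hα, smul_eq_mul,
        Finset.mul_sum]
      refine (Finset.sum_congr rfl fun j _ => ?_).trans (Finset.sum_subset
        (Finset.range_mono (show i + 1 ≤ n by omega)) ?_)
      · rw [PowerSeries.coeff_smul, smul_eq_mul, Complex.ofReal_re]
        have : iteratedDeriv j (iteratedDeriv V f.1) = iteratedDeriv (V + j) f.1 := by
          rw [iteratedDeriv_eq_iterate, iteratedDeriv_eq_iterate, iteratedDeriv_eq_iterate,
            add_comm, Function.iterate_add_apply]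
        rw [this]
        ring
      · intro j _ hj
        rw [PowerSeries.coeff_smul, PowerSeries.X_pow_dvd_iff.1 (pow_dvd_pow_of_dvd hαX j) i
          (by simpa using hj), smul_zero]
  have hfact : ∀ V j, ((iteratedDeriv (V + j) f.1 a₀ / ((V + j).factorial : ℝ) : ℝ) : ℂ) *
      ((V + j).choose V : ℂ) = (1 / (V.factorial : ℂ)) * (1 / (j.factorial : ℂ)) *
        (iteratedDeriv (V + j) f.1 a₀ : ℝ) := by
    intro V j
    rw [Nat.cast_add_choose]
    have h1 : ((V + j).factorial : ℂ) ≠ 0 := by exact_mod_cast (V + j).factorial_ne_zero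
    push_cast
    field_simp
  rw [hsymb, map_add, map_add, hrem, add_zero, map_sum, map_sum]
  simp only [hcomp, map_smul, map_sum, hterm, smul_eq_mul]
  -- With `k = V + j` the double sum over `V ≤ k < n` becomes a sum over the triangle `V + j < n`,
  -- which `hc0` enlarges to a square.
  have hflip := Finset.sum_range_diag_flip n fun V j =>
    (1 / (V.factorial : ℂ)) * (1 / (j.factorial : ℂ)) *
        (iteratedDeriv (V + j) f.1 a₀ : ℝ) * c V j
  refine (Finset.sum_congr rfl fun k _ => ?_).trans (hflip.trans ?_)
  · rw [Finset.mul_sum]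
    refine Finset.sum_congr rfl fun V hV => ?_
    obtain ⟨j, rfl⟩ := Nat.exists_eq_add_of_le (Nat.lt_succ_iff.1 (Finset.mem_range.1 hV))
    rw [Nat.add_sub_cancel_left, ← hfact, mul_assoc]
  · refine Finset.sum_congr rfl fun V _ => Finset.sum_subset
      (Finset.range_mono (Nat.sub_le n V)) fun j _ hj => ?_
    rw [hc0 V j (by have := Finset.mem_range.not.1 hj; omega), mul_zero]

/-! ### Relabeling of graphs -/

/-- The polynomial of `J^{μν} ∂_{v,μ} ∂_{w,ν}`. -/
def bracketPoly (N : ℕ) {V : ℕ} (v w : Fin V) : MvPolynomial (Fin V × PhaseIdx N) ℂ :=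
  ∑ μ, ∑ ν, C (poissonTensor N μ ν) * (X (v, μ) * X (w, ν))

/-- Antisymmetry of `J`, the source of all signs in `c_Γ`. -/
theorem bracketPoly_swap {V : ℕ} (v w : Fin V) : bracketPoly N w v = - bracketPoly N v w := by
  rw [bracketPoly, bracketPoly, sum_poissonTensor, sum_poissonTensor, ← Finset.sum_neg_distrib]
  exact Finset.sum_congr rfl fun j _ => by ring

theorem rename_bracketPoly {V : ℕ} (σ : Fin V → Fin V) (v w : Fin V) :
    MvPolynomial.rename (Prod.map σ id) (bracketPoly N v w) = bracketPoly N (σ v) (σ w) := by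
  simp [bracketPoly]

theorem graphPoly_eq_act {V E : ℕ} (Γ : LabeledGraph V E) (F : Fin V → Symbol N) :
    graphPoly Γ F = mapAlgHom (pullback (copiesMap V) (contDiff_copiesMap V))
      (act (PowerSeries.C (∏ e, bracketPoly N (Γ.tail e) (Γ.head e))) (tens F)) := by
  have h : ∏ e, bracketPoly N (Γ.tail e) (Γ.head e) = ∑ μ : Fin E → PhaseIdx N,
      ∑ ν : Fin E → PhaseIdx N, C (∏ e, poissonTensor N (μ e) (ν e)) *
      ((List.finRange E).map fun e => X (Γ.tail e, μ e) * X (Γ.head e, ν e)).prod := by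
    simp only [bracketPoly]
    rw [Fintype.prod_sum]
    refine Finset.sum_congr rfl fun μ _ => ?_
    rw [Fintype.prod_sum]
    refine Finset.sum_congr rfl fun ν _ => ?_
    rw [Finset.prod_mul_distrib, map_prod, ← Fin.prod_univ_def]
  rw [h]
  simp only [map_sum, LinearMap.sum_apply, graphPoly]
  refine Finset.sum_congr rfl fun μ _ => Finset.sum_congr rfl fun ν _ => ?_
  rw [map_mul PowerSeries.C, act_mul_apply, act_C_C, act_C_list_tens, map_smul,
    mapAlgHom_copiesMap_tens]
  rfl

/-- Permutation of the copies of phase space. -/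
def permMap {V : ℕ} (σ : Equiv.Perm (Fin V)) (w : Fin V × PhaseIdx N → ℝ) :
    Fin V × PhaseIdx N → ℝ := fun k => w (σ k.1, k.2)

theorem contDiff_permMap {V : ℕ} (σ : Equiv.Perm (Fin V)) : ContDiff ℝ ∞ (permMap (N := N) σ) := by
  unfold permMap
  fun_prop

/-- With the same `A` at every vertex, both the product function and the diagonal are invariant
under permutations of the copies. -/
theorem copiesMap_act_rename {V : ℕ} (σ : Equiv.Perm (Fin V)) (A : Symbol N)
    (P : MvPolynomial (Fin V × PhaseIdx N) ℂ) :
    mapAlgHom (pullback (copiesMap V) (contDiff_copiesMap V))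
      (act (PowerSeries.C (MvPolynomial.rename (Prod.map σ id) P)) (tens fun _ => A)) =
    mapAlgHom (pullback (copiesMap V) (contDiff_copiesMap V))
      (act (PowerSeries.C P) (tens fun _ => A)) := by
  have h1 : tens (fun _ : Fin V => A) =
      mapAlgHom (pullback (permMap σ) (contDiff_permMap σ)) (tens fun _ => A) := by
    rw [tens, map_prod, ← Equiv.prod_comp σ]
    rfl
  conv_lhs => rw [h1]
  rw [act_pullback (permMap σ) (contDiff_permMap σ) (fun i => permMap σ (Pi.single i 1))
    fun i w t => rfl, PowerSeries.map_C]
  have h2 : (MvPolynomial.aeval fun i => ∑ k, C ((permMap σ (Pi.single i (1 : ℝ)) k : ℝ) : ℂ) * X k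
      : MvPolynomial (Fin V × PhaseIdx N) ℂ →ₐ[ℂ] MvPolynomial (Fin V × PhaseIdx N) ℂ).toRingHom
      (MvPolynomial.rename (Prod.map σ id) P) = P := by
    change MvPolynomial.aeval _ (MvPolynomial.rename _ _) = _
    rw [MvPolynomial.aeval_rename]
    convert MvPolynomial.aeval_X_left_apply _
    refine funext fun k => ?_
    rw [Function.comp_apply, Finset.sum_eq_single k]
    · simp [permMap, Prod.map]
    · rintro ⟨v, μ⟩ _ hb
      rw [permMap, Pi.single_apply, if_neg]
      · simp
      · rintro h
        apply hb
        simpa [Prod.ext_iff] using h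
    · simp
  rw [h2]
  rfl

namespace LabeledGraph

variable {V E : ℕ}

/-- The number of edges that are inverted by a renumbering of the vertices. -/
def inversions (Γ : LabeledGraph V E) (σ : Equiv.Perm (Fin V)) : ℕ :=
  (Finset.univ.filter fun e : Fin E => σ (Γ.head e) < σ (Γ.tail e)).card

theorem smul_apply (g : Equiv.Perm (Fin V) × Equiv.Perm (Fin E)) (Γ : LabeledGraph V E)
    (e : Fin E) : ((g • Γ) (g.2 e)).1 = {g.1 (Γ.tail e), g.1 (Γ.head e)} := by
  change (Γ (g.2⁻¹ (g.2 e))).1.map g.1.toEmbedding = _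
  rw [show g.2⁻¹ (g.2 e) = e from g.2.symm_apply_apply e]
  have : (Γ e).1 = {Γ.tail e, Γ.head e} := Edge.eq_pair (Γ e)
  rw [this]
  simp

theorem bracketPoly_smul (g : Equiv.Perm (Fin V) × Equiv.Perm (Fin E)) (Γ : LabeledGraph V E)
    (e : Fin E) : bracketPoly N ((g • Γ).tail (g.2 e)) ((g • Γ).head (g.2 e)) =
      (if g.1 (Γ.head e) < g.1 (Γ.tail e) then -1 else 1) *
        bracketPoly N (g.1 (Γ.tail e)) (g.1 (Γ.head e)) := by
  have h := smul_apply g Γ e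
  have hne : g.1 (Γ.tail e) ≠ g.1 (Γ.head e) := fun h => (Γ.tail_lt_head e).ne (g.1.injective h)
  rcases hne.lt_or_gt with hlt | hlt
  · have h' : (g • Γ) (g.2 e) = Edge.mk hlt.ne := Subtype.ext h
    have ht : (g • Γ).tail (g.2 e) = g.1 (Γ.tail e) := by
      change Edge.tail ((g • Γ) (g.2 e)) = _
      rw [h', Edge.tail_mk hlt]
    have hh : (g • Γ).head (g.2 e) = g.1 (Γ.head e) := by
      change Edge.head ((g • Γ) (g.2 e)) = _
      rw [h', Edge.head_mk hlt]
    rw [ht, hh, if_neg hlt.not_gt, one_mul]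
  · have h' : (g • Γ) (g.2 e) = Edge.mk hlt.ne := Subtype.ext (h.trans (Finset.pair_comm _ _))
    have ht : (g • Γ).tail (g.2 e) = g.1 (Γ.head e) := by
      change Edge.tail ((g • Γ) (g.2 e)) = _
      rw [h', Edge.tail_mk hlt]
    have hh : (g • Γ).head (g.2 e) = g.1 (Γ.tail e) := by
      change Edge.head ((g • Γ) (g.2 e)) = _
      rw [h', Edge.head_mk hlt]
    rw [ht, hh, if_pos hlt, bracketPoly_swap, neg_one_mul]

/-- Permuting edges only reorders commuting factors; renumbering vertices reverses some arrows, each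
at the cost of a sign. -/
theorem graphPoly_smul (g : Equiv.Perm (Fin V) × Equiv.Perm (Fin E)) (Γ : LabeledGraph V E)
    (A : Symbol N) : (graphPoly (g • Γ) fun _ => A) =
      ((-1 : ℂ) ^ Γ.inversions g.1) • graphPoly Γ fun _ => A := by
  have h : ∏ e, bracketPoly N ((g • Γ).tail e) ((g • Γ).head e) =
      C ((-1 : ℂ) ^ Γ.inversions g.1) * MvPolynomial.rename (Prod.map g.1 id)
        (∏ e, bracketPoly N (Γ.tail e) (Γ.head e)) := by
    rw [← Equiv.prod_comp g.2]
    simp only [bracketPoly_smul, map_prod, rename_bracketPoly]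
    rw [Finset.prod_mul_distrib, Finset.prod_ite, Finset.prod_const, Finset.prod_const_one, mul_one,
      inversions]
    simp
  rw [graphPoly_eq_act, h, map_mul PowerSeries.C, act_mul_apply, act_C_C, map_smul,
    copiesMap_act_rename, ← graphPoly_eq_act]

theorem Reduced.smul {Γ : LabeledGraph V E} (hΓ : Γ.Reduced)
    (g : Equiv.Perm (Fin V) × Equiv.Perm (Fin E)) : (g • Γ).Reduced := by
  intro v
  obtain ⟨e, he⟩ := hΓ (g.1⁻¹ v)
  refine ⟨g.2 e, ?_⟩
  rw [smul_apply]
  rcases (Γ.mem_edge_iff e _).1 he with h | h <;> simp [h]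

theorem toGraph_eq_iff {Γ Γ' : LabeledGraph V E} : Γ'.toGraph = Γ.toGraph ↔
    ∃ g : Equiv.Perm (Fin V) × Equiv.Perm (Fin E), g • Γ = Γ' := by
  rw [toGraph, toGraph, Quotient.eq, MulAction.orbitRel_apply, MulAction.mem_orbit_iff]

theorem reduced_toGraph_iff {Γ : LabeledGraph V E} : Γ.toGraph.Reduced ↔ Γ.Reduced := by
  refine ⟨?_, fun h => ⟨Γ, rfl, h⟩⟩
  rintro ⟨Γ', h, hΓ'⟩
  obtain ⟨g, rfl⟩ := toGraph_eq_iff.1 h.symm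
  exact hΓ'.smul g

-- These group elements form a coset of the stabilizer.
open Classical in
theorem card_smul_eq (Γ Γ' : LabeledGraph V E) (h : Γ'.toGraph = Γ.toGraph) :
    (Finset.univ.filter fun g : Equiv.Perm (Fin V) × Equiv.Perm (Fin E) => g • Γ = Γ').card
      = Γ.symm := by
  obtain ⟨g₁, rfl⟩ := toGraph_eq_iff.1 h
  rw [LabeledGraph.symm, Nat.card_eq_fintype_card, Fintype.card_subtype]
  refine Finset.card_bij (fun g _ => g₁⁻¹ * g) ?_ ?_ ?_
  · intro g hg
    rw [Finset.mem_filter] at hg ⊢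
    refine ⟨Finset.mem_univ _, ?_⟩
    rw [MulAction.mem_stabilizer_iff, mul_smul, hg.2, inv_smul_smul]
  · intro g _ g' _ hgg
    exact mul_left_cancel hgg
  · intro g hg
    rw [Finset.mem_filter, MulAction.mem_stabilizer_iff] at hg
    refine ⟨g₁ * g, ?_, by simp⟩
    rw [Finset.mem_filter]
    exact ⟨Finset.mem_univ _, by rw [mul_smul, hg.2]⟩

theorem symm_ne_zero (Γ : LabeledGraph V E) : Γ.symm ≠ 0 := Nat.card_pos.ne'

open Classical in
/-- The sum over an orbit of labeled graphs. -/
theorem sum_orbit_graphPoly (Γ : LabeledGraph V E) (A : Symbol N) :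
    (1 / (E.factorial : ℂ)) • ∑ Γ' : LabeledGraph V E with Γ'.toGraph = Γ.toGraph,
      (graphPoly Γ' fun _ => A) = ((Γ.c : ℂ) / (Γ.symm : ℂ)) • graphPoly Γ fun _ => A := by
  -- The sum over the group is computed twice: here through signs, where edge permutations give
  -- `E!`, and in `h2` by grouping the elements according to the graph that they produce.
  have h1 : ∑ g : Equiv.Perm (Fin V) × Equiv.Perm (Fin E), (graphPoly (g • Γ) fun _ => A) =
      ((E.factorial : ℂ) * (Γ.c : ℂ)) • graphPoly Γ fun _ => A := by
    simp only [graphPoly_smul]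
    rw [← Finset.sum_smul, Fintype.sum_prod_type]
    congr 1
    simp only [Finset.sum_const, Finset.card_univ, Fintype.card_perm, Fintype.card_fin, nsmul_eq_mul]
    rw [← Finset.mul_sum, LabeledGraph.c]
    push_cast
    rfl
  have h2 : ∑ g : Equiv.Perm (Fin V) × Equiv.Perm (Fin E), (graphPoly (g • Γ) fun _ => A) =
      (Γ.symm : ℂ) • ∑ Γ' : LabeledGraph V E with Γ'.toGraph = Γ.toGraph,
        (graphPoly Γ' fun _ => A) := by
    rw [← Finset.sum_fiberwise_of_maps_to (s := Finset.univ)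
      (t := Finset.univ.filter fun Γ' : LabeledGraph V E => Γ'.toGraph = Γ.toGraph)
      (g := fun g : Equiv.Perm (Fin V) × Equiv.Perm (Fin E) => g • Γ), Finset.smul_sum]
    · refine Finset.sum_congr rfl fun Γ' hΓ' => ?_
      rw [Finset.sum_congr rfl (g := fun _ => graphPoly Γ' fun _ => A), Finset.sum_const,
        card_smul_eq Γ Γ' (Finset.mem_filter.1 hΓ').2, Nat.cast_smul_eq_nsmul]
      intro g hg
      rw [(Finset.mem_filter.1 hg).2]
    · intro g _
      exact Finset.mem_filter.2 ⟨Finset.mem_univ _, toGraph_eq_iff.2 ⟨g, rfl⟩⟩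
  have h3 := h2.symm.trans h1
  have hS : (Γ.symm : ℂ) ≠ 0 := by exact_mod_cast Γ.symm_ne_zero
  have hE : (E.factorial : ℂ) ≠ 0 := by exact_mod_cast E.factorial_ne_zero
  have h4 := congrArg (fun S => (1 / ((Γ.symm : ℂ) * (E.factorial : ℂ))) • S) h3
  simp only [smul_smul] at h4
  convert h4 using 2 <;> field_simp

end LabeledGraph

open Classical in
theorem unlabeledTerm_eq_sum {V E : ℕ} {f : ℝ → ℝ} (hf : ContDiff ℝ ∞ f) (A : Symbol N)
    (Γ : LabeledGraph V E) : unlabeledTerm f hf A Γ =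
      ∑ Γ' : LabeledGraph V E with Γ'.toGraph = Γ.toGraph, labeledTerm f hf A Γ' := by
  simp only [labeledTerm, unlabeledTerm]
  rw [← Finset.smul_sum, ← Finset.mul_sum, mul_right_comm, ← mul_smul_comm, ← mul_smul_comm,
    LabeledGraph.sum_orbit_graphPoly]

instance {V E : ℕ} : Finite (Graph V E) := Quotient.finite _

/-! ### Formal sums over graphs -/

theorem coeff_labeledTerm_eq_zero {V E : ℕ} {f : ℝ → ℝ} (hf : ContDiff ℝ ∞ f) (A : Symbol N)
    (Γ : LabeledGraph V E) {n : ℕ} (h : n < E) : PowerSeries.coeff n (labeledTerm f hf A Γ) = 0 := by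
  rw [labeledTerm, PowerSeries.coeff_smul, mul_assoc, coeff_planckFactor_mul, if_neg h.not_ge,
    smul_zero]

/-- At order `n` only `E ≤ n` contributes, and then `V ≤ 2E ≤ 2n`, which leaves finitely many
graphs. -/
theorem hasFormalSum_of_bounded {R : Type} [CommRing R] {T : ℕ → ℕ → Type}
    [∀ V E, Fintype (T V E)] (t : (Σ V : ℕ, Σ E : ℕ, T V E) → PowerSeries R) (B : PowerSeries R)
    (h0 : ∀ V E x n, n < E → PowerSeries.coeff n (t ⟨V, E, x⟩) = 0)
    (hT : ∀ V E, T V E → V ≤ 2 * E)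
    (hB : ∀ n, PowerSeries.coeff n B = ∑ V ∈ Finset.range (2 * n + 1), ∑ E ∈ Finset.range (n + 1),
      ∑ x : T V E, PowerSeries.coeff n (t ⟨V, E, x⟩)) : HasFormalSum t B := by
  intro n
  have hsub : (Function.support fun i => PowerSeries.coeff n (t i)) ⊆
      ((Finset.range (2 * n + 1)).sigma fun V => (Finset.range (n + 1)).sigma fun E =>
        (Finset.univ : Finset (T V E)) : Finset (Σ V : ℕ, Σ E : ℕ, T V E)) := by
    rintro ⟨V, E, x⟩ hx
    have hE : ¬ n < E := fun h => hx (h0 V E x n h)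
    have hV := hT V E x
    simp only [Finset.coe_sigma, Set.mem_sigma_iff, Finset.mem_coe, Finset.mem_range,
      Finset.mem_univ, and_true]
    omega
  refine ⟨(Finset.finite_toSet _).subset hsub, ?_⟩
  rw [finsum_eq_sum_of_support_subset _ hsub, hB, Finset.sum_sigma]
  exact Finset.sum_congr rfl fun V _ => Finset.sum_sigma _ _ _

open Classical in
theorem evalSymbol_sum_labeledTerm (V E : ℕ) {f : ℝ → ℝ} (hf : ContDiff ℝ ∞ f) (A : Symbol N)
    (z : PhaseIdx N → ℝ) : evalSymbol z
      (∑ Γ : {Γ : LabeledGraph V E // Γ.Reduced}, labeledTerm f hf A Γ.1) =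
      (1 / (V.factorial : ℂ)) • evalSymbol z (compSymbol (iteratedDeriv V f)
        (contDiff_iteratedDeriv hf V) A) * reducedSum V E z A := by
  have h := Finset.sum_subtype (Finset.univ.filter fun Γ : LabeledGraph V E => Γ.Reduced)
    (p := fun Γ => Γ.Reduced) (F := inferInstance) (by simp) fun Γ => labeledTerm f hf A Γ
  rw [← h, map_sum, reducedSum, Finset.mul_sum, mul_smul_comm, Finset.mul_sum, Finset.smul_sum]
  refine Finset.sum_congr rfl fun Γ _ => ?_
  rw [labeledTerm, map_smul, map_mul, map_mul, map_smul]
  congr 1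
  ring

open Classical in
theorem sum_unlabeledTerm (V E : ℕ) {f : ℝ → ℝ} (hf : ContDiff ℝ ∞ f) (A : Symbol N)
    (rep : Graph V E → LabeledGraph V E) (hrep : ∀ q, (rep q).toGraph = q)
    [Fintype {q : Graph V E // q.Reduced}] :
    ∑ q : {q : Graph V E // q.Reduced}, unlabeledTerm f hf A (rep q.1) =
      ∑ Γ : {Γ : LabeledGraph V E // Γ.Reduced}, labeledTerm f hf A Γ.1 := by
  let _ : Fintype (Graph V E) := Fintype.ofFinite _
  have h1 := Finset.sum_subtype (Finset.univ.filter fun Γ : LabeledGraph V E => Γ.Reduced)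
    (p := fun Γ => Γ.Reduced) (F := inferInstance) (by simp) fun Γ => labeledTerm f hf A Γ
  have h2 := Finset.sum_subtype (Finset.univ.filter fun q : Graph V E => q.Reduced)
    (p := fun q => q.Reduced) (F := inferInstance) (by simp) fun q => unlabeledTerm f hf A (rep q)
  rw [← h1, ← h2, ← Finset.sum_fiberwise_of_maps_to
    (s := Finset.univ.filter fun Γ : LabeledGraph V E => Γ.Reduced)
    (t := Finset.univ.filter fun q : Graph V E => q.Reduced) (g := LabeledGraph.toGraph)]
  · refine Finset.sum_congr rfl fun q hq => ?_
    rw [unlabeledTerm_eq_sum, hrep, Finset.filter_filter]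
    refine Finset.sum_congr (Finset.filter_congr fun Γ _ => ?_) fun _ _ => rfl
    refine ⟨?_, fun h => h.2⟩
    rintro rfl
    exact ⟨LabeledGraph.reduced_toGraph_iff.1 (Finset.mem_filter.1 hq).2, rfl⟩
  · intro Γ hΓ
    rw [Finset.mem_filter] at hΓ ⊢
    exact ⟨Finset.mem_univ _, LabeledGraph.reduced_toGraph_iff.2 hΓ.2⟩

end SymbolCalculus

end

open SymbolCalculus in
theorem mainTheorem1 (N : ℕ)
    -- the formal symbol `A`, with real-valued leading coefficient
    (A : Symbol N)
    (hA : ∀ z, ((PowerSeries.coeff 0 A).1 z).im = 0)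
    -- a functional calculus `f ↦ f(Â)` of `Â`: a morphism of algebras, with operators that have
    -- symbols as its values, which sends the coordinate function to `Â`
    (𝒜 : Subalgebra ℝ (ℝ → ℝ)) (h𝒜 : IsFunctionAlgebra 𝒜)
    (Φ : 𝒜 →ₐ[ℝ] Module.End ℂ (Wave N))
    (hΦ_id : Φ ⟨fun y => y, h𝒜.id_mem⟩ = weylOp A)
    (hΦ_symbol : ∀ g : 𝒜, ∃ C : Symbol N, Φ g = weylOp C)
    -- `B` is the symbol of `f(Â)`
    (f : 𝒜) (B : Symbol N) (hB : Φ f = weylOp B) :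
    -- the sum over reduced labeled graphs
    HasFormalSum
      (fun Γ : Σ V : ℕ, Σ E : ℕ, {Γ : LabeledGraph V E // Γ.Reduced} =>
        labeledTerm f.1 (h𝒜.smooth f.1 f.2) A Γ.2.2.1) B ∧
    -- the sum over reduced unlabeled graphs, for every choice of representatives
    ∀ rep : (V E : ℕ) → Graph V E → LabeledGraph V E,
      (∀ V E q, (rep V E q).toGraph = q) →
      HasFormalSum
        (fun q : Σ V : ℕ, Σ E : ℕ, {q : Graph V E // q.Reduced} =>
          unlabeledTerm f.1 (h𝒜.smooth f.1 f.2) A (rep q.1 q.2.1 q.2.2.1)) B := by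
  classical
  let _ (V E : ℕ) : Fintype {q : Graph V E // q.Reduced} := Fintype.ofFinite _
  have hf := h𝒜.smooth f.1 f.2
  -- The identity is checked point by point because the centre of the Taylor expansion depends on
  -- the point.
  have hcoeff : ∀ n, PowerSeries.coeff n B = ∑ V ∈ Finset.range (2 * n + 1),
      ∑ E ∈ Finset.range (n + 1), PowerSeries.coeff n
        (∑ Γ : {Γ : LabeledGraph V E // Γ.Reduced}, labeledTerm f.1 hf A Γ.1) := by
    intro n
    apply Subtype.ext
    funext z
    change evalAt z _ = evalAt z _
    rw [map_sum]
    refine (coeff_evalSymbol z B n).symm.trans ((coeff_evalSymbol_functional_calculus hA h𝒜 Φ hΦ_id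
      hΦ_symbol f B hB z n).trans (Finset.sum_congr rfl fun V _ => ?_))
    rw [map_sum]
    refine Finset.sum_congr rfl fun E _ => ?_
    rw [← evalSymbol_sum_labeledTerm, coeff_evalSymbol]
    rfl
  refine ⟨hasFormalSum_of_bounded _ B (fun V E Γ n h => coeff_labeledTerm_eq_zero _ A Γ.1 h)
    (fun V E Γ => Γ.2.le_two_mul) fun n => ?_, fun rep hrep => hasFormalSum_of_bounded _ B
    (fun V E q n h => ?_) (fun V E q => ?_) fun n => ?_⟩
  · simp only [hcoeff, map_sum]
  · change PowerSeries.coeff n (unlabeledTerm f.1 _ A (rep V E q.1)) = 0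
    rw [unlabeledTerm_eq_sum, map_sum]
    exact Finset.sum_eq_zero fun Γ _ => coeff_labeledTerm_eq_zero _ A Γ h
  · obtain ⟨Γ, -, hΓ⟩ := q.2
    exact hΓ.le_two_mul
  · rw [hcoeff]
    refine Finset.sum_congr rfl fun V _ => Finset.sum_congr rfl fun E _ => ?_
    rw [← sum_unlabeledTerm V E hf A (rep V E) (hrep V E), map_sum]
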